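/- Let $D\ge 1$, let $\alpha_1,\dots,\alpha_D>0$ with $\sum_c\alpha_c=1$, and let $g$ be a $D\times D$ matrix with positive real entries. Put $G_{cd}=\alpha_c g_{cd}^2$ and $\widehat G_{cd}=\alpha_c g_{dc}^2$, and let $\lambda$ be the Perron–Frobenius eigenvalue (equivalently, the spectral radius) of $G$. For $z\in\mathbb C$ and $\eta=\sqrt{-1}\,t$ with $t>0$, the system $$a_c=\frac{[G^{T}a]_c+\eta}{|z|^2-([\widehat G^{T}\widehat a]_c+\eta)([G^{T}a]_c+\eta)},\qquad \widehat a_c=\frac{[\widehat G^{T}\widehat a]_c+\eta}{|z|^2-([\widehat G^{T}\widehat a]_c+\eta)([G^{T}a]_c+\eta)}\qquad(1\le c\le D)$$ has a unique solution $a=a(z,\eta)$, $\widehat a=\widehat a(z,\eta)\in\mathbb C^D$ all of whose entries have positive imaginary part. Put $$b_c(z,\eta)=\frac{-z}{|z|^2-([\widehat G^{T}\widehat a]_c+\eta)([G^{T}a]_c+\eta)}.$$ There is a unique probability measure $\mu$ on $\mathbb C$ with $$\mu=-\frac1\pi\lim_{t\to0^+}\partial_z\sum_{c=1}^D\alpha_c\,b_c(z,\sqrt{-1}\,t)$$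 in the sense of distributions, i.e. $\int\varphi\,d\mu=\lim_{t\to0^+}\frac1\pi\int_{\mathbb C}\Big(\sum_c\alpha_c b_c(z,\sqrt{-1}\,t)\Big)\,\partial_z\varphi(z)\,d^2z$ for all $\varphi\in C_c^\infty(\mathbb C)$, where $\partial_z=\frac12(\partial_x-\sqrt{-1}\,\partial_y)$. (This $\mu$ is the limiting spectral measure of the random matrices with entries $g_{c_ic_j}J_{ij}$, where the $J_{ij}$ are i.i.d. centered with variance $1/N$ and $c_i$ is the block containing $i$, the $c$-th block having about $\alpha_cN$ indices.) Then $\mu$ is invariant under rotations about $0$, and its support is the closed disk $\{z\in\mathbb C:|z|\le\sqrt\lambda\}$. Moreover, if $|z|^2<\lambda$, there is $C_z>0$ such that $\big|\sum_c\alpha_c a_c(z,\sqrt{-1}\,t)\big|\ge C_z$ for all sufficiently small $t>0$; and if $|z|^2>\lambda$, then $a(z,\sqrt{-1}\,t)\to0$ and $\widehat a(z,\sqrt{-1}\,t)\to0$ as $t\to0^+$. -/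

import Mathlib

open scoped ContDiff

namespace BlockMatrix

/-- The matrix `G` with entries `G c d = α c * (g c d)²`. -/
def G {D : ℕ} (α : Fin D → ℝ) (g : Matrix (Fin D) (Fin D) ℝ) : Matrix (Fin D) (Fin D) ℝ :=
  Matrix.of fun c d => α c * g c d ^ 2

/-- The matrix `Ĝ` with entries `Ĝ c d = α c * (g d c)²`. -/
def Ghat {D : ℕ} (α : Fin D → ℝ) (g : Matrix (Fin D) (Fin D) ℝ) : Matrix (Fin D) (Fin D) ℝ :=
  Matrix.of fun c d => α c * g d c ^ 2

/-- The Perron–Frobenius eigenvalue of `G`, that is, the largest modulus of a complex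
eigenvalue of `G`. -/
noncomputable def perronEigenvalue {D : ℕ} (α : Fin D → ℝ)
    (g : Matrix (Fin D) (Fin D) ℝ) : ℝ :=
  (spectralRadius ℂ ((G α g).map (fun x : ℝ => (x : ℂ)))).toReal

/-- `[Gᵀ a]_c + η = ∑ d, α d * (g d c)² * a d + η`. -/
noncomputable def selfEnergy {D : ℕ} (α : Fin D → ℝ) (g : Matrix (Fin D) (Fin D) ℝ)
    (η : ℂ) (a : Fin D → ℂ) (c : Fin D) : ℂ :=
  ∑ d, (G α g d c : ℂ) * a d + η

/-- `[Ĝᵀ â]_c + η = ∑ d, α d * (g c d)² * â d + η`. -/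
noncomputable def selfEnergyHat {D : ℕ} (α : Fin D → ℝ) (g : Matrix (Fin D) (Fin D) ℝ)
    (η : ℂ) (a' : Fin D → ℂ) (c : Fin D) : ℂ :=
  ∑ d, (Ghat α g d c : ℂ) * a' d + η

/-- The common denominator `|z|² - ([Ĝᵀ â]_c + η) ([Gᵀ a]_c + η)`. -/
noncomputable def denom {D : ℕ} (α : Fin D → ℝ) (g : Matrix (Fin D) (Fin D) ℝ)
    (z η : ℂ) (a a' : Fin D → ℂ) (c : Fin D) : ℂ :=
  (‖z‖ : ℂ) ^ 2 - selfEnergyHat α g η a' c * selfEnergy α g η a c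

/-- `(a, â)` is a solution of the fixed-point equations at `(z, η)` with positive imaginary
parts. (Positivity excludes a vanishing denominator.) -/
structure IsSolution {D : ℕ} (α : Fin D → ℝ) (g : Matrix (Fin D) (Fin D) ℝ)
    (z η : ℂ) (a a' : Fin D → ℂ) : Prop where
  im_pos : ∀ c, 0 < (a c).im
  im_pos_hat : ∀ c, 0 < (a' c).im
  eq : ∀ c, a c = selfEnergy α g η a c / denom α g z η a a' c
  eq_hat : ∀ c, a' c = selfEnergyHat α g η a' c / denom α g z η a a' c

/-- `∑ c, α c * b c`, where `b c = -z / (|z|² - ([Ĝᵀ â]_c + η) ([Gᵀ a]_c + η))`. -/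
noncomputable def bTrace {D : ℕ} (α : Fin D → ℝ) (g : Matrix (Fin D) (Fin D) ℝ)
    (z η : ℂ) (a a' : Fin D → ℂ) : ℂ :=
  ∑ c, (α c : ℂ) * (-z / denom α g z η a a' c)

/-- The Wirtinger derivative `∂_z φ = (∂_x φ - i ∂_y φ) / 2`. -/
noncomputable def wirtinger (φ : ℂ → ℂ) (z : ℂ) : ℂ :=
  (1 / 2) * (fderiv ℝ φ z 1 - Complex.I * fderiv ℝ φ z Complex.I)

/-- `μ` is the probability measure `-(1/π) lim_{t → 0+} ∂_z ∑ c, α c * b c (z, i t)`; the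
derivative and the limit are in the sense of distributions on `ℂ`. -/
def IsLimitingMeasure {D : ℕ} (α : Fin D → ℝ) (g : Matrix (Fin D) (Fin D) ℝ)
    (μ : MeasureTheory.Measure ℂ) : Prop :=
  MeasureTheory.IsProbabilityMeasure μ ∧
  ∃ a a' : ℂ → ℝ → Fin D → ℂ,
    (∀ z : ℂ, ∀ t : ℝ, 0 < t → IsSolution α g z (t * Complex.I) (a z t) (a' z t)) ∧
    ∀ φ : ℂ → ℂ, ContDiff ℝ ∞ φ → HasCompactSupport φ →
      Filter.Tendsto
        (fun t : ℝ => (1 / (Real.pi : ℂ)) *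
          ∫ z : ℂ, bTrace α g z (t * Complex.I) (a z t) (a' z t) * wirtinger φ z)
        (nhdsWithin 0 (Set.Ioi 0)) (nhds (∫ z, φ z ∂μ))

end BlockMatrix

namespace BlockMatrix

open Filter Topology MeasureTheory

variable {D : ℕ} {α : Fin D → ℝ} {g : Matrix (Fin D) (Fin D) ℝ}

/-! ### Uniqueness of the solution in the upper half-plane -/

/-! Write `τ = |z|²`. For fixed `t > 0` the fixed-point map strictly contracts the ratio `‖a - b‖ /
√(Im a Im b)`, a function of the hyperbolic distance, so there is at most one solution
(`IsSolution.unique`). A solution of the form `(i v, i w)` with `v, w > 0` comes from the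
Knaster–Tarski theorem (`exists_isRealSolution`), so everything reduces to real vectors depending on
`τ` and `t` only.

Let `s` and `ŝ` be the energies of `v` and `w`, and `q_c = τ / (τ + ŝ_c s_c)`. Then `∑ α_c b_c =
-(z/|z|²) Q` with `Q = ∑ α_c q_c`. In polar coordinates, `-(1/π) ∂_z` of such a field is the
rotation invariant measure giving the disk of radius `r` the mass `Q(r)`, once `Q` is a distribution
function (`integral_radialMeasure_stieltjes`). Hence `μ` is determined by the limit of `Q` as `t →
0+`.

The central estimate is `log_sub_mul_meanWeight_sub`: a relative entropy comparison of two solutions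
bounds `(log τ₁ - log τ₂)(Q₁ - Q₂)` below by a sum of nonnegative terms. It makes `Q` monotone in
`τ` and, by its equality case, injective in `τ`, also at `t = 0`. So the limit is a distribution
function that is strictly increasing below the critical radius.

The critical radius comes from pairing the equation with a positive right eigenvector `x` of `G`
(`IsRealSolution.perron_pairing`): `∑ x_c v_c (τ - λ + ŝ_c s_c) = t ∑ x_c`. If `τ > λ`, every term
is nonnegative, so the solution tends to `0` and `Q → 1`. If `τ < λ`, some `ŝ_c s_c` exceeds `λ -
τ`, so the solution stays away from `0`; compactness gives solutions at `t = 0`, all with the same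
`Q`. -/

lemma im_div_sub_mul (E F : ℂ) (x : ℝ) (hN : (x : ℂ) ^ 2 - F * E ≠ 0) :
    (E / ((x : ℂ) ^ 2 - F * E)).im = (x / ‖(x : ℂ) ^ 2 - F * E‖) ^ 2 * E.im
      + ‖E / ((x : ℂ) ^ 2 - F * E)‖ ^ 2 * F.im := by
  set N := (x : ℂ) ^ 2 - F * E with hNdef
  have h0 : Complex.normSq N ≠ 0 := by simpa using hN
  have hre : N.re = x ^ 2 - (F.re * E.re - F.im * E.im) := by
    simp [hNdef, pow_two]
  have him : N.im = -(F.re * E.im + F.im * E.re) := by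
    simp [hNdef, pow_two]
  rw [Complex.div_im, norm_div, div_pow, div_pow, Complex.sq_norm, Complex.sq_norm,
    Complex.normSq_apply E]
  field_simp
  rw [hre, him]
  ring

/-- The polarized companion of `im_div_sub_mul`: the same two coefficients govern differences and
imaginary parts, which is what lets Cauchy–Schwarz compare them. -/
lemma div_sub_div_of_denom (E₁ F₁ E₂ F₂ x : ℂ) (h₁ : x ^ 2 - F₁ * E₁ ≠ 0)
    (h₂ : x ^ 2 - F₂ * E₂ ≠ 0) :
    E₁ / (x ^ 2 - F₁ * E₁) - E₂ / (x ^ 2 - F₂ * E₂)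
      = (x / (x ^ 2 - F₁ * E₁)) * (x / (x ^ 2 - F₂ * E₂)) * (E₁ - E₂)
        + (E₁ / (x ^ 2 - F₁ * E₁)) * (E₂ / (x ^ 2 - F₂ * E₂)) * (F₁ - F₂) := by
  rw [div_sub_div _ _ h₁ h₂, div_mul_div_comm, div_mul_div_comm, div_mul_eq_mul_div,
    div_mul_eq_mul_div, ← add_div]
  congr 1
  ring

/-- Cauchy–Schwarz in the plane. Strictness must come from the `A` terms, since `β₁` and `β₂` vanish
when `z = 0`. -/
lemma weighted_sqrt_mul_lt {β₁ β₂ A₁ A₂ X₁ X₂ Y₁ Y₂ x₁ x₂ y₁ y₂ : ℝ}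
    (hA₁ : 0 < A₁) (hA₂ : 0 < A₂)
    (hX₁ : 0 ≤ X₁) (hX₂ : 0 ≤ X₂) (hY₁ : 0 ≤ Y₁) (hY₂ : 0 ≤ Y₂)
    (hx₁ : X₁ < x₁) (hx₂ : X₂ < x₂) (hy₁ : Y₁ < y₁) (hy₂ : Y₂ < y₂) :
    β₁ * β₂ * (√X₁ * √X₂) + A₁ * A₂ * (√Y₁ * √Y₂)
      < √(β₁ ^ 2 * x₁ + A₁ ^ 2 * y₁) * √(β₂ ^ 2 * x₂ + A₂ ^ 2 * y₂) := by
  have e₁ := Real.sq_sqrt hX₁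
  have e₂ := Real.sq_sqrt hX₂
  have e₃ := Real.sq_sqrt hY₁
  have e₄ := Real.sq_sqrt hY₂
  have l₁ : β₁ ^ 2 * X₁ + A₁ ^ 2 * Y₁ < β₁ ^ 2 * x₁ + A₁ ^ 2 * y₁ :=
    add_lt_add_of_le_of_lt (by gcongr) (by gcongr)
  have l₂ : β₂ ^ 2 * X₂ + A₂ ^ 2 * Y₂ < β₂ ^ 2 * x₂ + A₂ ^ 2 * y₂ :=
    add_lt_add_of_le_of_lt (by gcongr) (by gcongr)
  have n₁ : 0 ≤ β₁ ^ 2 * X₁ + A₁ ^ 2 * Y₁ := by positivity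
  have n₂ : 0 ≤ β₂ ^ 2 * X₂ + A₂ ^ 2 * Y₂ := by positivity
  rw [← Real.sqrt_mul (n₁.trans l₁.le)]
  apply Real.lt_sqrt_of_sq_lt
  calc (β₁ * β₂ * (√X₁ * √X₂) + A₁ * A₂ * (√Y₁ * √Y₂)) ^ 2
      ≤ (β₁ ^ 2 * √X₁ ^ 2 + A₁ ^ 2 * √Y₁ ^ 2) * (β₂ ^ 2 * √X₂ ^ 2 + A₂ ^ 2 * √Y₂ ^ 2) := by
        nlinarith [sq_nonneg (β₁ * √X₁ * (A₂ * √Y₂) - A₁ * √Y₁ * (β₂ * √X₂))]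
    _ = (β₁ ^ 2 * X₁ + A₁ ^ 2 * Y₁) * (β₂ ^ 2 * X₂ + A₂ ^ 2 * Y₂) := by rw [e₁, e₂, e₃, e₄]
    _ < _ := mul_lt_mul'' l₁ l₂ n₁ n₂

lemma G_nonneg (hα : ∀ c, 0 < α c) (c d : Fin D) : 0 ≤ G α g c d :=
  mul_nonneg (hα c).le (sq_nonneg _)

lemma Ghat_nonneg (hα : ∀ c, 0 < α c) (c d : Fin D) : 0 ≤ Ghat α g c d :=
  mul_nonneg (hα c).le (sq_nonneg _)

lemma IsSolution.denom_ne_zero {z η : ℂ} {a a' : Fin D → ℂ} (h : IsSolution α g z η a a')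
    (c : Fin D) : denom α g z η a a' c ≠ 0 := by
  intro h0
  have h1 := h.im_pos c
  rw [h.eq c, h0] at h1
  simp at h1

/-- Weighted sums of entries whose differences are dominated by geometric means of imaginary
parts are dominated in the same way. -/
lemma norm_weighted_sum_sub_le {ι : Type*} [Fintype ι] {r : ℝ} (hr : 0 ≤ r) (k : ι → ℝ)
    (hk : ∀ d, 0 ≤ k d) (x y : ι → ℂ) (hx : ∀ d, 0 < (x d).im) (hy : ∀ d, 0 < (y d).im)
    (h : ∀ d, ‖x d - y d‖ ≤ r * (√(x d).im * √(y d).im)) (η : ℂ) :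
    ‖(∑ d, (k d : ℂ) * x d + η) - (∑ d, (k d : ℂ) * y d + η)‖
      ≤ r * (√(∑ d, k d * (x d).im) * √(∑ d, k d * (y d).im)) := by
  rw [add_sub_add_right_eq_sub, ← Finset.sum_sub_distrib]
  calc ‖∑ d, ((k d : ℂ) * x d - (k d : ℂ) * y d)‖
      ≤ ∑ d, ‖(k d : ℂ) * x d - (k d : ℂ) * y d‖ := norm_sum_le _ _
    _ ≤ ∑ d, r * (√(k d * (x d).im) * √(k d * (y d).im)) := by
        refine Finset.sum_le_sum fun d _ => ?_
        rw [← mul_sub, norm_mul, Complex.norm_real, Real.norm_of_nonneg (hk d),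
          Real.sqrt_mul (hk d), Real.sqrt_mul (hk d)]
        calc k d * ‖x d - y d‖ ≤ k d * (r * (√(x d).im * √(y d).im)) :=
              mul_le_mul_of_nonneg_left (h d) (hk d)
          _ = r * (√(k d) * √(k d) * (√(x d).im * √(y d).im)) := by
              rw [Real.mul_self_sqrt (hk d)]; ring
          _ = _ := by ring
    _ ≤ _ := by
        rw [← Finset.mul_sum]
        refine mul_le_mul_of_nonneg_left ?_ hr
        exact Real.sum_sqrt_mul_sqrt_le _ (fun d => mul_nonneg (hk d) (hx d).le)
          (fun d => mul_nonneg (hk d) (hy d).le)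

/-- One step of the contraction: `E` and `F` exceed the weighted sums `X`, `Y` in imaginary part
because of the added `i t`, and this makes the final inequality strict. -/
lemma norm_div_sub_div_lt {E₁ F₁ E₂ F₂ : ℂ} {x r X₁ X₂ Y₁ Y₂ : ℝ} (hr : 0 < r)
    (h₁ : (x : ℂ) ^ 2 - F₁ * E₁ ≠ 0) (h₂ : (x : ℂ) ^ 2 - F₂ * E₂ ≠ 0)
    (hE₁ : E₁ ≠ 0) (hE₂ : E₂ ≠ 0)
    (hX₁ : 0 ≤ X₁) (hX₂ : 0 ≤ X₂) (hY₁ : 0 ≤ Y₁) (hY₂ : 0 ≤ Y₂)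
    (hx₁ : X₁ < E₁.im) (hx₂ : X₂ < E₂.im) (hy₁ : Y₁ < F₁.im) (hy₂ : Y₂ < F₂.im)
    (hE : ‖E₁ - E₂‖ ≤ r * (√X₁ * √X₂)) (hF : ‖F₁ - F₂‖ ≤ r * (√Y₁ * √Y₂)) :
    ‖E₁ / ((x : ℂ) ^ 2 - F₁ * E₁) - E₂ / ((x : ℂ) ^ 2 - F₂ * E₂)‖
      < r * (√(E₁ / ((x : ℂ) ^ 2 - F₁ * E₁)).im * √(E₂ / ((x : ℂ) ^ 2 - F₂ * E₂)).im) := by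
  rw [im_div_sub_mul _ _ _ h₁, im_div_sub_mul _ _ _ h₂, div_sub_div_of_denom _ _ _ _ _ h₁ h₂]
  set N₁ := (x : ℂ) ^ 2 - F₁ * E₁
  set N₂ := (x : ℂ) ^ 2 - F₂ * E₂
  have hA₁ : 0 < ‖E₁ / N₁‖ := norm_pos_iff.2 (div_ne_zero hE₁ h₁)
  have hA₂ : 0 < ‖E₂ / N₂‖ := norm_pos_iff.2 (div_ne_zero hE₂ h₂)
  have key := weighted_sqrt_mul_lt (β₁ := |x| / ‖N₁‖) (β₂ := |x| / ‖N₂‖)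
    hA₁ hA₂ hX₁ hX₂ hY₁ hY₂ hx₁ hx₂ hy₁ hy₂
  have hb : ∀ N : ℂ, ‖(x : ℂ) / N‖ = |x| / ‖N‖ := fun N => by
    rw [norm_div, Complex.norm_real, Real.norm_eq_abs]
  have hsq : ∀ N : ℂ, (|x| / ‖N‖) ^ 2 = (x / ‖N‖) ^ 2 := fun N => by
    rw [div_pow, div_pow, sq_abs]
  rw [hsq, hsq] at key
  calc _ ≤ ‖(x : ℂ) / N₁ * (x / N₂) * (E₁ - E₂)‖ + ‖E₁ / N₁ * (E₂ / N₂) * (F₁ - F₂)‖ :=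
        norm_add_le _ _
    _ = |x| / ‖N₁‖ * (|x| / ‖N₂‖) * ‖E₁ - E₂‖ + ‖E₁ / N₁‖ * ‖E₂ / N₂‖ * ‖F₁ - F₂‖ := by
        rw [norm_mul, norm_mul, norm_mul, norm_mul, hb, hb]
    _ ≤ |x| / ‖N₁‖ * (|x| / ‖N₂‖) * (r * (√X₁ * √X₂))
        + ‖E₁ / N₁‖ * ‖E₂ / N₂‖ * (r * (√Y₁ * √Y₂)) := by gcongr
    _ = r * (|x| / ‖N₁‖ * (|x| / ‖N₂‖) * (√X₁ * √X₂)
        + ‖E₁ / N₁‖ * ‖E₂ / N₂‖ * (√Y₁ * √Y₂)) := by ring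
    _ < _ := mul_lt_mul_of_pos_left key hr

theorem IsSolution.unique (hα : ∀ c, 0 < α c) {z : ℂ} {t : ℝ} (ht : 0 < t)
    {a a' b b' : Fin D → ℂ} (h₁ : IsSolution α g z (t * Complex.I) a a')
    (h₂ : IsSolution α g z (t * Complex.I) b b') : a = b ∧ a' = b' := by
  rcases isEmpty_or_nonempty (Fin D) with hD | hD
  · exact ⟨Subsingleton.elim _ _, Subsingleton.elim _ _⟩
  have im_sum : ∀ (k : Fin D → ℝ) (x : Fin D → ℂ),
      (∑ d, (k d : ℂ) * x d + t * Complex.I).im = ∑ d, k d * (x d).im + t := by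
    intro k x
    simp [Complex.im_sum]
  have sum_lt : ∀ (k : Fin D → ℝ) (x : Fin D → ℂ),
      ∑ d, k d * (x d).im < (∑ d, (k d : ℂ) * x d + t * Complex.I).im := by
    intro k x
    rw [im_sum]; linarith
  have sum_nonneg : ∀ (k : Fin D → ℝ) (x : Fin D → ℂ), (∀ d, 0 ≤ k d) → (∀ d, 0 < (x d).im) →
      0 ≤ ∑ d, k d * (x d).im := fun k x hk hx =>
    Finset.sum_nonneg fun d _ => mul_nonneg (hk d) (hx d).le
  have ne_zero : ∀ (k : Fin D → ℝ) (x : Fin D → ℂ), (∀ d, 0 ≤ k d) → (∀ d, 0 < (x d).im) →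
      (∑ d, (k d : ℂ) * x d + t * Complex.I) ≠ 0 := by
    intro k x hk hx h0
    have h1 := (sum_nonneg k x hk hx).trans_lt (sum_lt k x)
    rw [h0] at h1
    simp at h1
  -- The ratio is maximized over both halves jointly, because each entry of either half involves the
  -- energies of both. At a maximizer with positive ratio the strict contraction is contradictory.
  set f : Fin D ⊕ Fin D → ℝ := Sum.elim
    (fun c => ‖a c - b c‖ / (√(a c).im * √(b c).im))
    (fun c => ‖a' c - b' c‖ / (√(a' c).im * √(b' c).im)) with hf
  obtain ⟨k, -, hk⟩ := Finset.exists_max_image Finset.univ f Finset.univ_nonempty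
  have hu : ∀ c, 0 < √(a c).im * √(b c).im := fun c =>
    mul_pos (Real.sqrt_pos.2 (h₁.im_pos c)) (Real.sqrt_pos.2 (h₂.im_pos c))
  have hu' : ∀ c, 0 < √(a' c).im * √(b' c).im := fun c =>
    mul_pos (Real.sqrt_pos.2 (h₁.im_pos_hat c)) (Real.sqrt_pos.2 (h₂.im_pos_hat c))
  have hle : ∀ c, ‖a c - b c‖ ≤ f k * (√(a c).im * √(b c).im) := fun c =>
    (div_le_iff₀ (hu c)).1 (hk (Sum.inl c) (Finset.mem_univ _))
  have hle' : ∀ c, ‖a' c - b' c‖ ≤ f k * (√(a' c).im * √(b' c).im) := fun c =>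
    (div_le_iff₀ (hu' c)).1 (hk (Sum.inr c) (Finset.mem_univ _))
  have hf0 : 0 ≤ f k := by
    rcases k with c | c
    · exact div_nonneg (norm_nonneg _) (hu c).le
    · exact div_nonneg (norm_nonneg _) (hu' c).le
  rcases hf0.eq_or_lt with h0 | hpos
  · refine ⟨funext fun c => ?_, funext fun c => ?_⟩
    · have := hle c
      rw [← h0, zero_mul, norm_le_zero_iff] at this
      exact sub_eq_zero.1 this
    · have := hle' c
      rw [← h0, zero_mul, norm_le_zero_iff] at this
      exact sub_eq_zero.1 this
  · exfalso
    have bE : ∀ c, _ := fun c => norm_weighted_sum_sub_le hf0 (fun d => G α g d c)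
      (fun d => G_nonneg hα d c) a b h₁.im_pos h₂.im_pos hle (t * Complex.I)
    have bF : ∀ c, _ := fun c => norm_weighted_sum_sub_le hf0 (fun d => Ghat α g d c)
      (fun d => Ghat_nonneg hα d c) a' b' h₁.im_pos_hat h₂.im_pos_hat hle' (t * Complex.I)
    rcases k with c | c
    · have hN₁ := h₁.denom_ne_zero c
      have hN₂ := h₂.denom_ne_zero c
      have := norm_div_sub_div_lt (x := ‖z‖) hpos hN₁ hN₂
        (ne_zero _ _ (fun d => G_nonneg hα d c) h₁.im_pos)
        (ne_zero _ _ (fun d => G_nonneg hα d c) h₂.im_pos)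
        (sum_nonneg _ _ (fun d => G_nonneg hα d c) h₁.im_pos)
        (sum_nonneg _ _ (fun d => G_nonneg hα d c) h₂.im_pos)
        (sum_nonneg _ _ (fun d => Ghat_nonneg hα d c) h₁.im_pos_hat)
        (sum_nonneg _ _ (fun d => Ghat_nonneg hα d c) h₂.im_pos_hat)
        (sum_lt _ _) (sum_lt _ _) (sum_lt _ _) (sum_lt _ _) (bE c) (bF c)
      have e₁ := h₁.eq c
      have e₂ := h₂.eq c
      simp only [denom, selfEnergy, selfEnergyHat] at e₁ e₂ this
      rw [← e₁, ← e₂, ← div_lt_iff₀ (hu c)] at this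
      exact lt_irrefl _ this
    · have hN₁ := h₁.denom_ne_zero c
      have hN₂ := h₂.denom_ne_zero c
      have e₁ := h₁.eq_hat c
      have e₂ := h₂.eq_hat c
      simp only [denom, selfEnergy, selfEnergyHat] at e₁ e₂ hN₁ hN₂
      -- Swapping the factors of the denominator exchanges the roles of the two energies, so the
      -- same contraction lemma applies.
      rw [mul_comm (∑ d, (Ghat α g d c : ℂ) * a' d + t * Complex.I)] at e₁ hN₁
      rw [mul_comm (∑ d, (Ghat α g d c : ℂ) * b' d + t * Complex.I)] at e₂ hN₂
      have := norm_div_sub_div_lt (x := ‖z‖) hpos hN₁ hN₂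
        (ne_zero _ _ (fun d => Ghat_nonneg hα d c) h₁.im_pos_hat)
        (ne_zero _ _ (fun d => Ghat_nonneg hα d c) h₂.im_pos_hat)
        (sum_nonneg _ _ (fun d => Ghat_nonneg hα d c) h₁.im_pos_hat)
        (sum_nonneg _ _ (fun d => Ghat_nonneg hα d c) h₂.im_pos_hat)
        (sum_nonneg _ _ (fun d => G_nonneg hα d c) h₁.im_pos)
        (sum_nonneg _ _ (fun d => G_nonneg hα d c) h₂.im_pos)
        (sum_lt _ _) (sum_lt _ _) (sum_lt _ _) (sum_lt _ _) (bF c) (bE c)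
      rw [← e₁, ← e₂, ← div_lt_iff₀ (hu' c)] at this
      exact lt_irrefl _ this

/-! ### Existence of a purely imaginary solution -/

/-- `[Gᵀ v]_c + t` for real `v`. -/
def energy (α : Fin D → ℝ) (g : Matrix (Fin D) (Fin D) ℝ) (t : ℝ) (v : Fin D → ℝ)
    (c : Fin D) : ℝ :=
  ∑ d, G α g d c * v d + t

/-- `[Ĝᵀ w]_c + t` for real `w`. -/
def energyHat (α : Fin D → ℝ) (g : Matrix (Fin D) (Fin D) ℝ) (t : ℝ) (w : Fin D → ℝ)
    (c : Fin D) : ℝ :=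
  ∑ d, Ghat α g d c * w d + t

/-- `(i v, i w)` is a solution of the fixed-point equations at `|z|² = τ`, `η = i t`. -/
structure IsRealSolution (α : Fin D → ℝ) (g : Matrix (Fin D) (Fin D) ℝ) (τ t : ℝ)
    (v w : Fin D → ℝ) : Prop where
  pos : ∀ c, 0 < v c
  pos_hat : ∀ c, 0 < w c
  eq : ∀ c, v c = energy α g t v c / (τ + energyHat α g t w c * energy α g t v c)
  eq_hat : ∀ c, w c = energyHat α g t w c / (τ + energyHat α g t w c * energy α g t v c)

lemma div_add_mul_le_div_add_mul {τ x x' y y' : ℝ} (hτ : 0 ≤ τ) (hx : 0 < x) (hy' : 0 < y')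
    (hxx : x ≤ x') (hyy : y' ≤ y) : x / (τ + y * x) ≤ x' / (τ + y' * x') := by
  have hx' := hx.trans_le hxx
  have hy := hy'.trans_le hyy
  rw [div_le_div_iff₀ (by positivity) (by positivity)]
  have h1 : x * τ ≤ x' * τ := by gcongr
  have h2 : x * (y' * x') ≤ x' * (y * x) := by
    have : x * x' * y' ≤ x * x' * y := by gcongr
    linarith
  linarith

/-- The function `x / (τ + y x)` increases in `x` and decreases in `y`. With the order of the second
half reversed, the fixed-point map is therefore monotone on a complete lattice. -/
theorem exists_isRealSolution (hα : ∀ c, 0 < α c) {τ t : ℝ} (hτ : 0 ≤ τ) (ht : 0 < t) :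
    ∃ v w, IsRealSolution α g τ t v w := by
  have hT : (0 : ℝ) ≤ 1 / t := by positivity
  have : Fact ((0 : ℝ) ≤ 1 / t) := ⟨hT⟩
  have e_ge : ∀ v : Fin D → ℝ, (∀ c, 0 ≤ v c) → ∀ c, t ≤ energy α g t v c := fun v hv c =>
    le_add_of_nonneg_left (Finset.sum_nonneg fun d _ => mul_nonneg (G_nonneg hα d c) (hv d))
  have f_ge : ∀ v : Fin D → ℝ, (∀ c, 0 ≤ v c) → ∀ c, t ≤ energyHat α g t v c := fun v hv c =>
    le_add_of_nonneg_left (Finset.sum_nonneg fun d _ => mul_nonneg (Ghat_nonneg hα d c) (hv d))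
  -- The value is at most `1 / y ≤ 1 / t`, so the cube of side `1 / t` is mapped to itself.
  have bound : ∀ x y : ℝ, t ≤ x → t ≤ y → x / (τ + y * x) ∈ Set.Icc 0 (1 / t) := by
    intro x y hx hy
    have hx0 := ht.trans_le hx
    have hy0 := ht.trans_le hy
    refine ⟨by positivity, ?_⟩
    rw [div_le_div_iff₀ (by positivity) ht]
    have : x * t ≤ y * x := by rw [mul_comm]; gcongr
    linarith
  let L := (Fin D → Set.Icc (0 : ℝ) (1 / t)) × (Fin D → Set.Icc (0 : ℝ) (1 / t))ᵒᵈ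
  let V : L → Fin D → ℝ := fun p c => (p.1 c : ℝ)
  let W : L → Fin D → ℝ := fun p c => (OrderDual.ofDual p.2 c : ℝ)
  have hV : ∀ p c, 0 ≤ V p c := fun p c => (p.1 c).2.1
  have hW : ∀ p c, 0 ≤ W p c := fun p c => (OrderDual.ofDual p.2 c).2.1
  have V_mono : ∀ p q : L, p ≤ q → ∀ c, energy α g t (V p) c ≤ energy α g t (V q) c :=
    fun p q h c => add_le_add_left (Finset.sum_le_sum fun d _ =>
      mul_le_mul_of_nonneg_left (show V p d ≤ V q d from h.1 d) (G_nonneg hα d c)) t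
  have W_anti : ∀ p q : L, p ≤ q → ∀ c, energyHat α g t (W q) c ≤ energyHat α g t (W p) c :=
    fun p q h c => add_le_add_left (Finset.sum_le_sum fun d _ =>
      mul_le_mul_of_nonneg_left (show W q d ≤ W p d from h.2 d) (Ghat_nonneg hα d c)) t
  let F : L →o L :=
    { toFun := fun p => (fun c => ⟨_, bound _ _ (e_ge _ (hV p) c) (f_ge _ (hW p) c)⟩,
        OrderDual.toDual fun c => ⟨_, bound _ _ (f_ge _ (hW p) c) (e_ge _ (hV p) c)⟩)
      monotone' := by
        intro p q h
        refine ⟨fun c => ?_, fun c => ?_⟩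
        · exact div_add_mul_le_div_add_mul hτ (ht.trans_le (e_ge _ (hV p) c))
            (ht.trans_le (f_ge _ (hW q) c)) (V_mono p q h c) (W_anti p q h c)
        · exact div_add_mul_le_div_add_mul hτ (ht.trans_le (f_ge _ (hW q) c))
            (ht.trans_le (e_ge _ (hV p) c)) (W_anti p q h c) (V_mono p q h c) }
  have hfix : F F.lfp = F.lfp := F.map_lfp
  have e₁ : ∀ c, V F.lfp c = energy α g t (V F.lfp) c /
      (τ + energyHat α g t (W F.lfp) c * energy α g t (V F.lfp) c) := fun c =>
    (congrArg (fun p => V p c) hfix).symm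
  have e₂ : ∀ c, W F.lfp c = energyHat α g t (W F.lfp) c /
      (τ + energyHat α g t (W F.lfp) c * energy α g t (V F.lfp) c) := fun c => by
    rw [mul_comm (energyHat α g t (W F.lfp) c)]
    exact (congrArg (fun p => W p c) hfix).symm
  -- The lattice contains vectors with zero entries; positivity of the fixed point follows because
  -- both energies are at least `t`.
  have hE : ∀ c, 0 < energy α g t (V F.lfp) c := fun c => ht.trans_le (e_ge _ (hV _) c)
  have hF : ∀ c, 0 < energyHat α g t (W F.lfp) c := fun c => ht.trans_le (f_ge _ (hW _) c)
  refine ⟨V F.lfp, W F.lfp, fun c => ?_, fun c => ?_, e₁, e₂⟩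
  · rw [e₁ c]
    have := hE c
    have := hF c
    positivity
  · rw [e₂ c]
    have := hE c
    have := hF c
    positivity

lemma selfEnergy_ofReal_mul_I (t : ℝ) (v : Fin D → ℝ) (c : Fin D) :
    selfEnergy α g (t * Complex.I) (fun d => v d * Complex.I) c
      = energy α g t v c * Complex.I := by
  simp only [selfEnergy, energy, Complex.ofReal_add, Complex.ofReal_sum, Complex.ofReal_mul,
    add_mul, Finset.sum_mul, mul_assoc]

lemma selfEnergyHat_ofReal_mul_I (t : ℝ) (w : Fin D → ℝ) (c : Fin D) :
    selfEnergyHat α g (t * Complex.I) (fun d => w d * Complex.I) c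
      = energyHat α g t w c * Complex.I := by
  simp only [selfEnergyHat, energyHat, Complex.ofReal_add, Complex.ofReal_sum,
    Complex.ofReal_mul, add_mul, Finset.sum_mul, mul_assoc]

lemma denom_ofReal_mul_I (z : ℂ) (t : ℝ) (v w : Fin D → ℝ) (c : Fin D) :
    denom α g z (t * Complex.I) (fun d => v d * Complex.I) (fun d => w d * Complex.I) c
      = ((‖z‖ ^ 2 + energyHat α g t w c * energy α g t v c : ℝ) : ℂ) := by
  rw [denom, selfEnergy_ofReal_mul_I, selfEnergyHat_ofReal_mul_I]
  push_cast
  linear_combination (-(energyHat α g t w c * energy α g t v c : ℂ)) * Complex.I_mul_I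

lemma IsRealSolution.isSolution {z : ℂ} {t : ℝ} {v w : Fin D → ℝ}
    (h : IsRealSolution α g (‖z‖ ^ 2) t v w) :
    IsSolution α g z (t * Complex.I) (fun d => v d * Complex.I) (fun d => w d * Complex.I) where
  im_pos c := by simpa using h.pos c
  im_pos_hat c := by simpa using h.pos_hat c
  eq c := by
    rw [denom_ofReal_mul_I, selfEnergy_ofReal_mul_I, mul_div_right_comm, ← Complex.ofReal_div,
      ← h.eq c]
  eq_hat c := by
    rw [denom_ofReal_mul_I, selfEnergyHat_ofReal_mul_I, mul_div_right_comm, ← Complex.ofReal_div,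
      ← h.eq_hat c]

theorem existsUnique_isSolution (hα : ∀ c, 0 < α c) (z : ℂ) {t : ℝ} (ht : 0 < t) :
    ∃! p : (Fin D → ℂ) × (Fin D → ℂ), IsSolution α g z (t * Complex.I) p.1 p.2 := by
  obtain ⟨v, w, h⟩ := exists_isRealSolution (g := g) hα (sq_nonneg ‖z‖) ht
  refine ⟨(_, _), h.isSolution, fun p hp => ?_⟩
  obtain ⟨e₁, e₂⟩ := hp.unique hα ht h.isSolution
  exact Prod.ext e₁ e₂

/-! ### The Perron–Frobenius eigenvector -/

/-- The Collatz–Wielandt argument: take the largest `k` with `k x ≤ A x` for some `x` in the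
simplex. If `A x ≠ k x`, then `A` maps the nonzero nonnegative vector `A x - k x` to a strictly
positive one, so `y = A x` satisfies `A y > k y` and allows a larger `k`. -/
theorem exists_pos_eigenvector {ι : Type*} [Fintype ι] [Nonempty ι] {A : Matrix ι ι ℝ}
    (hA : ∀ i j, 0 < A i j) :
    ∃ k : ℝ, 0 < k ∧ ∃ x : ι → ℝ, (∀ i, 0 < x i) ∧ ∀ i, ∑ j, A i j * x j = k * x i := by
  classical
  let K : Set ((ι → ℝ) × ℝ) :=
    {p | p.1 ∈ stdSimplex ℝ ι ∧ 0 ≤ p.2 ∧ ∀ i, p.2 * p.1 i ≤ ∑ j, A i j * p.1 j}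
  have mem_le : ∀ p ∈ K, p.2 ≤ ∑ i, ∑ j, A i j := by
    rintro ⟨x, k⟩ ⟨hx, hk, h⟩
    calc k = ∑ i, k * x i := by rw [← Finset.mul_sum, hx.2, mul_one]
      _ ≤ ∑ i, ∑ j, A i j * x j := Finset.sum_le_sum fun i _ => h i
      _ ≤ ∑ i, ∑ j, A i j := by
          refine Finset.sum_le_sum fun i _ => Finset.sum_le_sum fun j _ => ?_
          have hxj : x j ≤ 1 := by
            rw [← hx.2]
            exact Finset.single_le_sum (fun i _ => hx.1 i) (Finset.mem_univ j)
          exact mul_le_of_le_one_right (hA i j).le hxj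
  have hclosed : IsClosed K := by
    have h1 : IsClosed {p : (ι → ℝ) × ℝ | p.1 ∈ stdSimplex ℝ ι} :=
      (isClosed_stdSimplex ℝ ι).preimage continuous_fst
    have h2 : IsClosed {p : (ι → ℝ) × ℝ | 0 ≤ p.2} := isClosed_le continuous_const continuous_snd
    have h3 : IsClosed {p : (ι → ℝ) × ℝ | ∀ i, p.2 * p.1 i ≤ ∑ j, A i j * p.1 j} := by
      simp only [Set.ofPred_forall]
      exact isClosed_iInter fun i => isClosed_le (by fun_prop) (by fun_prop)
    exact h1.inter (h2.inter h3)
  have hcompact : IsCompact K :=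
    ((isCompact_stdSimplex ℝ ι).prod isCompact_Icc).of_isClosed_subset hclosed
      (fun p hp => ⟨hp.1, hp.2.1, mem_le p hp⟩)
  have hne : K.Nonempty := by
    obtain ⟨i⟩ := ‹Nonempty ι›
    refine ⟨(Pi.single i 1, 0), single_mem_stdSimplex ℝ i, le_rfl, fun j => ?_⟩
    rw [zero_mul]
    refine Finset.sum_nonneg fun l _ => mul_nonneg (hA j l).le ?_
    exact (single_mem_stdSimplex ℝ i).1 l
  obtain ⟨⟨x, k⟩, ⟨hx, hk, h⟩, hmax⟩ := hcompact.exists_isMaxOn hne continuous_snd.continuousOn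
  simp only at hx hk h
  obtain ⟨i₀, hi₀⟩ : ∃ i, 0 < x i := by
    by_contra! hc
    have : ∑ i, x i ≤ 0 := Finset.sum_nonpos fun i _ => hc i
    linarith [hx.2]
  have pos_of : ∀ y : ι → ℝ, (∀ j, 0 ≤ y j) → (∃ j, 0 < y j) → ∀ i, 0 < ∑ j, A i j * y j := by
    rintro y hy ⟨j, hj⟩ i
    exact Finset.sum_pos' (fun j _ => mul_nonneg (hA i j).le (hy j))
      ⟨j, Finset.mem_univ _, mul_pos (hA i j) hj⟩
  set y : ι → ℝ := fun i => ∑ j, A i j * x j with hy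
  have hypos : ∀ i, 0 < y i := pos_of x hx.1 ⟨i₀, hi₀⟩
  have heq : ∀ i, y i = k * x i := by
    by_contra! hc
    obtain ⟨i₁, hi₁⟩ := hc
    have hlt : ∀ i, k * y i < ∑ j, A i j * y j := by
      intro i
      have := pos_of (fun j => y j - k * x j) (fun j => sub_nonneg.2 (h j))
        ⟨i₁, sub_pos.2 (lt_of_le_of_ne (h i₁) (Ne.symm hi₁))⟩ i
      have e : ∑ j, A i j * (y j - k * x j) = ∑ j, A i j * y j - k * y i := by
        simp only [mul_sub, Finset.sum_sub_distrib, hy, Finset.mul_sum]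
        congr 1
        exact Finset.sum_congr rfl fun j _ => by ring
      linarith
    -- The smallest ratio `(A y)_i / y_i` is the improved constant; `y` is then normalized to return
    -- to the simplex.
    obtain ⟨m, -, hm⟩ := Finset.exists_min_image Finset.univ
      (fun i => (∑ j, A i j * y j) / y i) Finset.univ_nonempty
    set k' := (∑ j, A m j * y j) / y m with hk'
    have hkk' : k < k' := by rw [hk', lt_div_iff₀ (hypos m)]; exact hlt m
    have hS : 0 < ∑ i, y i := Finset.sum_pos (fun i _ => hypos i) Finset.univ_nonempty
    have hmem : ((fun i => y i / ∑ i, y i), k') ∈ K := by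
      refine ⟨⟨fun i => (div_pos (hypos i) hS).le, ?_⟩, hk.trans hkk'.le, fun i => ?_⟩
      · simp only
        rw [← Finset.sum_div, div_self hS.ne']
      · have h1 := (le_div_iff₀ (hypos i)).1 (hm i (Finset.mem_univ _))
        simp only [mul_div_assoc', ← Finset.sum_div]
        exact div_le_div_of_nonneg_right h1 hS.le
    exact absurd (hmax hmem) (not_le.2 hkk')
  have hkx : ∀ i, 0 < k * x i := fun i => heq i ▸ hypos i
  have hkpos : 0 < k := pos_of_mul_pos_left (hkx i₀) hi₀.le
  exact ⟨k, hkpos, x, fun i => pos_of_mul_pos_right (hkx i) hk, heq⟩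

/-- A positive matrix with a positive eigenvector has the corresponding eigenvalue as its
spectral radius. -/
theorem spectralRadius_map_ofReal {ι : Type*} [Fintype ι] [DecidableEq ι] [Nonempty ι]
    {A : Matrix ι ι ℝ} (hA : ∀ i j, 0 < A i j) {k : ℝ} (hk : 0 < k) {x : ι → ℝ}
    (hx : ∀ i, 0 < x i) (h : ∀ i, ∑ j, A i j * x j = k * x i) :
    spectralRadius ℂ (A.map (fun y : ℝ => (y : ℂ))) = ENNReal.ofReal k := by
  have mem_iff : ∀ μ : ℂ, μ ∈ spectrum ℂ (A.map (fun y : ℝ => (y : ℂ))) ↔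
      ∃ u : ι → ℂ, u ≠ 0 ∧ ∀ i, ∑ j, (A i j : ℂ) * u j = μ * u i := by
    intro μ
    rw [spectrum.mem_iff, Matrix.isUnit_iff_isUnit_det, isUnit_iff_ne_zero, not_not,
      ← Matrix.exists_mulVec_eq_zero_iff]
    refine exists_congr fun u => and_congr_right fun _ => ?_
    rw [Matrix.sub_mulVec, sub_eq_zero, funext_iff]
    refine forall_congr' fun i => ?_
    rw [Matrix.algebraMap_eq_diagonal, Matrix.mulVec_diagonal]
    simp only [Matrix.mulVec, dotProduct, Matrix.map_apply]
    exact eq_comm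
  apply le_antisymm
  · refine iSup₂_le fun μ hμ => ?_
    obtain ⟨u, hu, he⟩ := (mem_iff μ).1 hμ
    -- The index where `|u|` is largest relative to `x`: there the eigenvalue equation for `u` is
    -- dominated by the one for `x`.
    obtain ⟨m, -, hm⟩ := Finset.exists_max_image Finset.univ (fun i => ‖u i‖ / x i)
      Finset.univ_nonempty
    have hle : ∀ j, ‖u j‖ ≤ ‖u m‖ / x m * x j := fun j =>
      (div_le_iff₀ (hx j)).1 (hm j (Finset.mem_univ _))
    have hum : 0 < ‖u m‖ := by
      refine (norm_nonneg _).lt_of_ne fun h0 => hu (funext fun j => ?_)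
      have := hle j
      rw [← h0, zero_div, zero_mul] at this
      exact norm_le_zero_iff.1 this
    have : ‖μ‖ * ‖u m‖ ≤ k * ‖u m‖ := by
      calc ‖μ‖ * ‖u m‖ = ‖∑ j, (A m j : ℂ) * u j‖ := by rw [he m, norm_mul]
        _ ≤ ∑ j, A m j * (‖u m‖ / x m * x j) := by
            refine (norm_sum_le _ _).trans (Finset.sum_le_sum fun j _ => ?_)
            rw [norm_mul, Complex.norm_real, Real.norm_of_nonneg (hA m j).le]
            exact mul_le_mul_of_nonneg_left (hle j) (hA m j).le
        _ = ‖u m‖ / x m * ∑ j, A m j * x j := by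
            rw [Finset.mul_sum]
            exact Finset.sum_congr rfl fun j _ => by ring
        _ = k * ‖u m‖ := by
            rw [h m]
            have := (hx m).ne'
            field_simp
    have hμk : ‖μ‖ ≤ k := le_of_mul_le_mul_right this hum
    rw [← ENNReal.ofReal_coe_nnreal, coe_nnnorm]
    exact ENNReal.ofReal_le_ofReal hμk
  · have hmem : (k : ℂ) ∈ spectrum ℂ (A.map (fun y : ℝ => (y : ℂ))) := by
      refine (mem_iff _).2 ⟨fun i => (x i : ℂ), fun h0 => ?_, fun i => ?_⟩
      · obtain ⟨i⟩ := ‹Nonempty ι›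
        have := congrFun h0 i
        exact (hx i).ne' (by simpa using this)
      · simp only
        exact_mod_cast h i
    refine le_trans ?_ (le_iSup₂ (f := fun (μ : ℂ) (_ : μ ∈ spectrum ℂ _) => (‖μ‖₊ : ENNReal))
      (k : ℂ) hmem)
    rw [← ENNReal.ofReal_coe_nnreal, coe_nnnorm, Complex.norm_real, Real.norm_of_nonneg hk.le]

theorem perronEigenvalue_spec [Nonempty (Fin D)] (hα : ∀ c, 0 < α c) (hg : ∀ c d, 0 < g c d) :
    0 < perronEigenvalue α g ∧ ∃ x : Fin D → ℝ, (∀ c, 0 < x c) ∧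
      ∀ c, ∑ d, G α g c d * x d = perronEigenvalue α g * x c := by
  have hG : ∀ c d, 0 < G α g c d := fun c d => mul_pos (hα c) (pow_pos (hg c d) 2)
  obtain ⟨k, hk, x, hx, h⟩ := exists_pos_eigenvector hG
  have : perronEigenvalue α g = k := by
    rw [perronEigenvalue, spectralRadius_map_ofReal hG hk hx h, ENNReal.toReal_ofReal hk.le]
  rw [this]
  exact ⟨hk, x, hx, h⟩

/-! ### Identities and bounds for real solutions -/

/-- The weight `τ / (τ + ([Ĝᵀ w]_c + t) ([Gᵀ v]_c + t))`. -/
noncomputable def weight (α : Fin D → ℝ) (g : Matrix (Fin D) (Fin D) ℝ) (τ t : ℝ)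
    (v w : Fin D → ℝ) (c : Fin D) : ℝ :=
  τ / (τ + energyHat α g t w c * energy α g t v c)

/-- The mean of the weights with respect to `α`. -/
noncomputable def meanWeight (α : Fin D → ℝ) (g : Matrix (Fin D) (Fin D) ℝ) (τ t : ℝ)
    (v w : Fin D → ℝ) : ℝ :=
  ∑ c, α c * weight α g τ t v w c

lemma energy_pos (hα : ∀ c, 0 < α c) (hg : ∀ c d, 0 < g c d) {t : ℝ} (ht : 0 ≤ t)
    {v : Fin D → ℝ} (hv : ∀ c, 0 < v c) (c : Fin D) : 0 < energy α g t v c :=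
  add_pos_of_pos_of_nonneg (Finset.sum_pos (fun d _ =>
    mul_pos (mul_pos (hα d) (pow_pos (hg d c) 2)) (hv d)) ⟨c, Finset.mem_univ c⟩) ht

lemma energyHat_pos (hα : ∀ c, 0 < α c) (hg : ∀ c d, 0 < g c d) {t : ℝ} (ht : 0 ≤ t)
    {w : Fin D → ℝ} (hw : ∀ c, 0 < w c) (c : Fin D) : 0 < energyHat α g t w c :=
  add_pos_of_pos_of_nonneg (Finset.sum_pos (fun d _ =>
    mul_pos (mul_pos (hα d) (pow_pos (hg c d) 2)) (hw d)) ⟨c, Finset.mem_univ c⟩) ht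

/-- Both sides are the pair weight `α_c α_d g_{cd}²`. This symmetry is what allows double sums over
the two halves to be exchanged. -/
lemma alpha_mul_Ghat (c d : Fin D) : α c * Ghat α g d c = α d * G α g c d := by
  simp only [Ghat, G, Matrix.of_apply]; ring

namespace IsRealSolution

variable {τ t : ℝ} {v w : Fin D → ℝ}

lemma energy_pos (h : IsRealSolution α g τ t v w) (hα : ∀ c, 0 < α c) (hg : ∀ c d, 0 < g c d)
    (ht : 0 ≤ t) (c : Fin D) : 0 < energy α g t v c :=
  BlockMatrix.energy_pos hα hg ht h.pos c

lemma energyHat_pos (h : IsRealSolution α g τ t v w) (hα : ∀ c, 0 < α c)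
    (hg : ∀ c d, 0 < g c d) (ht : 0 ≤ t) (c : Fin D) : 0 < energyHat α g t w c :=
  BlockMatrix.energyHat_pos hα hg ht h.pos_hat c

lemma denom_pos (h : IsRealSolution α g τ t v w) (hα : ∀ c, 0 < α c) (hg : ∀ c d, 0 < g c d)
    (hτ : 0 ≤ τ) (ht : 0 ≤ t) (c : Fin D) :
    0 < τ + energyHat α g t w c * energy α g t v c :=
  add_pos_of_nonneg_of_pos hτ (mul_pos (h.energyHat_pos hα hg ht c) (h.energy_pos hα hg ht c))

lemma mul_energyHat_eq (h : IsRealSolution α g τ t v w) (c : Fin D) :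
    v c * energyHat α g t w c = w c * energy α g t v c := by
  rw [h.eq c, h.eq_hat c]; ring

lemma mul_energyHat (h : IsRealSolution α g τ t v w) (hα : ∀ c, 0 < α c)
    (hg : ∀ c d, 0 < g c d) (hτ : 0 ≤ τ) (ht : 0 ≤ t) (c : Fin D) :
    v c * energyHat α g t w c = 1 - weight α g τ t v w c := by
  have := (h.denom_pos hα hg hτ ht c).ne'
  rw [h.eq c, weight, eq_sub_iff_add_eq, div_mul_eq_mul_div, ← add_div, div_eq_one_iff_eq this]
  ring

lemma weight_mul_energyHat (h : IsRealSolution α g τ t v w) (c : Fin D) :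
    weight α g τ t v w c * energyHat α g t w c = τ * w c := by
  rw [h.eq_hat c, weight]; ring

lemma weight_pos (h : IsRealSolution α g τ t v w) (hα : ∀ c, 0 < α c) (hg : ∀ c d, 0 < g c d)
    (hτ : 0 < τ) (ht : 0 ≤ t) (c : Fin D) : 0 < weight α g τ t v w c :=
  div_pos hτ (h.denom_pos hα hg hτ.le ht c)

lemma weight_nonneg (h : IsRealSolution α g τ t v w) (hα : ∀ c, 0 < α c) (hg : ∀ c d, 0 < g c d)
    (hτ : 0 ≤ τ) (ht : 0 ≤ t) (c : Fin D) : 0 ≤ weight α g τ t v w c :=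
  div_nonneg hτ (h.denom_pos hα hg hτ ht c).le

lemma weight_lt_one (h : IsRealSolution α g τ t v w) (hα : ∀ c, 0 < α c)
    (hg : ∀ c d, 0 < g c d) (hτ : 0 ≤ τ) (ht : 0 ≤ t) (c : Fin D) :
    weight α g τ t v w c < 1 := by
  have := mul_pos (h.pos c) (h.energyHat_pos hα hg ht c)
  rw [h.mul_energyHat hα hg hτ ht c] at this
  linarith

lemma meanWeight_nonneg (h : IsRealSolution α g τ t v w) (hα : ∀ c, 0 < α c)
    (hg : ∀ c d, 0 < g c d) (hτ : 0 ≤ τ) (ht : 0 ≤ t) : 0 ≤ meanWeight α g τ t v w :=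
  Finset.sum_nonneg fun c _ => mul_nonneg (hα c).le (h.weight_nonneg hα hg hτ ht c)

lemma meanWeight_le_one (h : IsRealSolution α g τ t v w) (hα : ∀ c, 0 < α c)
    (hsum : ∑ c, α c = 1) (hg : ∀ c d, 0 < g c d) (hτ : 0 ≤ τ) (ht : 0 ≤ t) :
    meanWeight α g τ t v w ≤ 1 := by
  rw [← hsum]
  exact Finset.sum_le_sum fun c _ =>
    mul_le_of_le_one_right (hα c).le (h.weight_lt_one hα hg hτ ht c).le

/-- The `α`-means of the two halves of a solution agree. -/
lemma sum_eq_sum_hat (h : IsRealSolution α g τ t v w) (ht : 0 < t) :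
    ∑ c, α c * v c = ∑ c, α c * w c := by
  -- Both sides contain the same bilinear form in `v` and `w`. It cancels and leaves `t` times the
  -- two means, so `t > 0` is essential.
  have h1 : ∑ c, α c * (v c * energyHat α g t w c) = ∑ c, α c * (w c * energy α g t v c) :=
    Finset.sum_congr rfl fun c _ => by rw [h.mul_energyHat_eq]
  have h2 : ∑ c, α c * (v c * energyHat α g t w c)
      = ∑ c, ∑ d, α c * Ghat α g d c * v c * w d + t * ∑ c, α c * v c := by
    rw [Finset.mul_sum, ← Finset.sum_add_distrib]
    refine Finset.sum_congr rfl fun c _ => ?_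
    rw [energyHat, mul_add, mul_add, Finset.mul_sum, Finset.mul_sum]
    congr 1
    · exact Finset.sum_congr rfl fun d _ => by ring
    · ring
  have h3 : ∑ c, α c * (w c * energy α g t v c)
      = ∑ c, ∑ d, α c * Ghat α g d c * v c * w d + t * ∑ c, α c * w c := by
    rw [Finset.sum_comm, Finset.mul_sum, ← Finset.sum_add_distrib]
    refine Finset.sum_congr rfl fun c _ => ?_
    rw [energy, mul_add, mul_add, Finset.mul_sum, Finset.mul_sum]
    congr 1
    · exact Finset.sum_congr rfl fun d _ => by rw [alpha_mul_Ghat]; ring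
    · ring
  rw [h2, h3] at h1
  exact mul_left_cancel₀ ht.ne' (add_left_cancel h1)

end IsRealSolution

/-! ### Monotonicity in `τ` -/

/-- Applying `log u ≤ u - 1` to `u = √(y / x)` instead of `y / x` retains the squared Hellinger
term, which later settles the equality case. -/
lemma sub_add_sq_le_mul_log_sub_log {x y : ℝ} (hx : 0 < x) (hy : 0 < y) :
    x - y + (√x - √y) ^ 2 ≤ x * (Real.log x - Real.log y) := by
  have hsx := Real.sqrt_pos.2 hx
  have hsy := Real.sqrt_pos.2 hy
  have ex := Real.sq_sqrt hx.le
  have ey := Real.sq_sqrt hy.le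
  have h := Real.log_le_sub_one_of_pos (div_pos hsy hsx)
  rw [Real.log_div hsy.ne' hsx.ne', Real.log_sqrt hy.le, Real.log_sqrt hx.le] at h
  have h2 : 2 * x * (√y / √x) = 2 * (√x * √y) := by
    nth_rw 1 [← ex]
    field_simp
  nlinarith

lemma sub_mul_log_sub_log_nonneg {x y : ℝ} (hx : 0 < x) (hy : 0 < y) :
    0 ≤ (x - y) * (Real.log x - Real.log y) := by
  rcases le_total x y with h | h
  · exact mul_nonneg_of_nonpos_of_nonpos (sub_nonpos.2 h)
      (sub_nonpos.2 (Real.log_le_log hx h))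
  · exact mul_nonneg (sub_nonneg.2 h) (sub_nonneg.2 (Real.log_le_log hy h))

lemma eq_of_sub_mul_log_sub_log {x y : ℝ} (hx : 0 < x) (hy : 0 < y)
    (h : (x - y) * (Real.log x - Real.log y) = 0) : x = y := by
  rcases mul_eq_zero.1 h with h | h
  · exact sub_eq_zero.1 h
  · exact Real.log_injOn_pos hx hy (sub_eq_zero.1 h)

/-- A symmetrized relative entropy bound for two subprobability vectors `k i / σ`, `l i / ρ` with
defects `t / σ` and `t / ρ`. -/
lemma entropy_bound {ι : Type*} [Fintype ι] {k l : ι → ℝ} {σ ρ t x y : ℝ}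
    (hk : ∀ i, 0 < k i) (hl : ∀ i, 0 < l i) (hσ : 0 < σ) (hρ : 0 < ρ) (ht : 0 ≤ t)
    (hx : 0 ≤ x) (hy : 0 ≤ y) (hks : ∑ i, k i + t = σ) (hls : ∑ i, l i + t = ρ) :
    (x * σ + y * ρ) * ∑ i, (√(k i / σ) - √(l i / ρ)) ^ 2
      ≤ ∑ i, (x * k i - y * l i) * (Real.log (k i) - Real.log (l i))
        - (x * σ - y * ρ) * (Real.log σ - Real.log ρ) := by
  have main : ∀ (k l : ι → ℝ) (σ ρ x : ℝ), (∀ i, 0 < k i) → (∀ i, 0 < l i) → 0 < σ → 0 < ρ →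
      0 ≤ x → ∑ i, k i + t = σ → ∑ i, l i + t = ρ →
      x * σ * ∑ i, (√(k i / σ) - √(l i / ρ)) ^ 2 ≤
        ∑ i, x * k i * (Real.log (k i) - Real.log (l i)) - x * σ * (Real.log σ - Real.log ρ) := by
    intro k l σ ρ x hk hl hσ hρ hx hks hls
    have h1 : ∑ i, (k i / σ - l i / ρ + (√(k i / σ) - √(l i / ρ)) ^ 2)
        ≤ ∑ i, k i / σ * (Real.log (k i / σ) - Real.log (l i / ρ)) :=
      Finset.sum_le_sum fun i _ =>
        sub_add_sq_le_mul_log_sub_log (div_pos (hk i) hσ) (div_pos (hl i) hρ)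
    -- After multiplication by `t` this is the contribution of an extra atom of mass `t / σ`,
    -- respectively `t / ρ`, which completes both vectors to probability vectors.
    have h2 : σ⁻¹ - ρ⁻¹ ≤ σ⁻¹ * (Real.log σ⁻¹ - Real.log ρ⁻¹) := by
      have := sub_add_sq_le_mul_log_sub_log (inv_pos.2 hσ) (inv_pos.2 hρ)
      linarith [sq_nonneg (√σ⁻¹ - √ρ⁻¹)]
    rw [Real.log_inv, Real.log_inv] at h2
    have h3 := mul_le_mul_of_nonneg_left h2 ht
    rw [Finset.sum_add_distrib, Finset.sum_sub_distrib, ← Finset.sum_div, ← Finset.sum_div] at h1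
    have h4 : ∑ i, k i / σ * (Real.log (k i / σ) - Real.log (l i / ρ))
        = (∑ i, k i * (Real.log (k i) - Real.log (l i))) / σ
          - (∑ i, k i) / σ * (Real.log σ - Real.log ρ) := by
      rw [Finset.sum_div, Finset.sum_div, Finset.sum_mul, ← Finset.sum_sub_distrib]
      refine Finset.sum_congr rfl fun i _ => ?_
      rw [Real.log_div (hk i).ne' hσ.ne', Real.log_div (hl i).ne' hρ.ne']
      ring
    rw [h4] at h1
    have e1 : ∑ i, k i = σ - t := by linarith
    have e2 : ∑ i, l i = ρ - t := by linarith
    rw [e1, e2] at h1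
    have e3 : (σ - t) / σ = 1 - t * σ⁻¹ := by field_simp
    have e4 : (ρ - t) / ρ = 1 - t * ρ⁻¹ := by field_simp
    rw [e3, e4] at h1
    have h5 : ∑ i, (√(k i / σ) - √(l i / ρ)) ^ 2
        ≤ (∑ i, k i * (Real.log (k i) - Real.log (l i))) / σ - (Real.log σ - Real.log ρ) := by
      nlinarith
    have h6 := mul_le_mul_of_nonneg_left h5 (mul_nonneg hx hσ.le)
    refine h6.trans (le_of_eq ?_)
    simp only [mul_assoc, ← Finset.mul_sum]
    field_simp
  have m1 := main k l σ ρ x hk hl hσ hρ hx hks hls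
  have m2 := main l k ρ σ y hl hk hρ hσ hy hls hks
  have e : ∑ i, (√(l i / ρ) - √(k i / σ)) ^ 2 = ∑ i, (√(k i / σ) - √(l i / ρ)) ^ 2 :=
    Finset.sum_congr rfl fun i _ => by ring
  have e' : ∑ i, (x * k i - y * l i) * (Real.log (k i) - Real.log (l i))
      = ∑ i, x * k i * (Real.log (k i) - Real.log (l i))
        + ∑ i, y * l i * (Real.log (l i) - Real.log (k i)) := by
    rw [← Finset.sum_add_distrib]
    exact Finset.sum_congr rfl fun i _ => by ring
  rw [e] at m2
  rw [e']
  linarith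

/-- The weighted coefficients `Ĝ_dc w_d` of `[Ĝᵀ w]_c + t`, normalized. -/
noncomputable def transition (α : Fin D → ℝ) (g : Matrix (Fin D) (Fin D) ℝ) (t : ℝ)
    (w : Fin D → ℝ) (c d : Fin D) : ℝ :=
  Ghat α g d c * w d / energyHat α g t w c

/-- For each `c` the entropy bound compares the rows `transition` of the two solutions, weighted by
`v₁ c` and `v₂ c`. After averaging over `α`, the logarithms combine through `log w - log ŝ = log q -
log τ`, and `v ŝ = 1 - q` turns the coefficients into differences of weights. -/
theorem log_sub_mul_meanWeight_sub (hα : ∀ c, 0 < α c) (hg : ∀ c d, 0 < g c d)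
    {τ₁ τ₂ t : ℝ} (hτ₁ : 0 < τ₁) (hτ₂ : 0 < τ₂) (ht : 0 ≤ t) {v₁ w₁ v₂ w₂ : Fin D → ℝ}
    (h₁ : IsRealSolution α g τ₁ t v₁ w₁) (h₂ : IsRealSolution α g τ₂ t v₂ w₂) :
    ∑ c, α c * ((weight α g τ₁ t v₁ w₁ c - weight α g τ₂ t v₂ w₂ c) *
        (Real.log (weight α g τ₁ t v₁ w₁ c) - Real.log (weight α g τ₂ t v₂ w₂ c)))
      + ∑ c, α c * ((v₁ c * energyHat α g t w₁ c + v₂ c * energyHat α g t w₂ c) *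
        ∑ d, (√(transition α g t w₁ c d) - √(transition α g t w₂ c d)) ^ 2)
      ≤ (Real.log τ₁ - Real.log τ₂)
        * (meanWeight α g τ₁ t v₁ w₁ - meanWeight α g τ₂ t v₂ w₂) := by
  have hGh : ∀ c d, 0 < Ghat α g d c := fun c d => mul_pos (hα d) (pow_pos (hg c d) 2)
  have row : ∀ c, (v₁ c * energyHat α g t w₁ c + v₂ c * energyHat α g t w₂ c) *
        ∑ d, (√(transition α g t w₁ c d) - √(transition α g t w₂ c d)) ^ 2
      ≤ ∑ d, Ghat α g d c * (v₁ c * w₁ d - v₂ c * w₂ d) * (Real.log (w₁ d) - Real.log (w₂ d))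
        - (v₁ c * energyHat α g t w₁ c - v₂ c * energyHat α g t w₂ c)
          * (Real.log (energyHat α g t w₁ c) - Real.log (energyHat α g t w₂ c)) := by
    intro c
    have := entropy_bound (k := fun d => Ghat α g d c * w₁ d) (l := fun d => Ghat α g d c * w₂ d)
      (fun d => mul_pos (hGh c d) (h₁.pos_hat d)) (fun d => mul_pos (hGh c d) (h₂.pos_hat d))
      (h₁.energyHat_pos hα hg ht c) (h₂.energyHat_pos hα hg ht c) ht (h₁.pos c).le (h₂.pos c).le
      rfl rfl
    refine this.trans (le_of_eq ?_)
    congr 1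
    refine Finset.sum_congr rfl fun d _ => ?_
    rw [Real.log_mul (hGh c d).ne' (h₁.pos_hat d).ne',
      Real.log_mul (hGh c d).ne' (h₂.pos_hat d).ne']
    ring
  have tot := Finset.sum_le_sum fun c (_ : c ∈ Finset.univ) =>
    mul_le_mul_of_nonneg_left (row c) (hα c).le
  -- Summing over `c` first rebuilds `[Gᵀ v]_d = s_d - t`, and `w s = v ŝ` brings back the
  -- quantities of the row estimate. The leftover `t` term has a favourable sign by monotonicity of
  -- `log`.
  have col : ∑ c, α c * ∑ d, Ghat α g d c * (v₁ c * w₁ d - v₂ c * w₂ d)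
        * (Real.log (w₁ d) - Real.log (w₂ d))
      = ∑ c, α c * (((v₁ c * energyHat α g t w₁ c - v₂ c * energyHat α g t w₂ c)
          - t * (w₁ c - w₂ c)) * (Real.log (w₁ c) - Real.log (w₂ c))) := by
    simp only [Finset.mul_sum]
    rw [Finset.sum_comm]
    refine Finset.sum_congr rfl fun d _ => ?_
    have e : ∀ (v w : Fin D → ℝ), w d * energy α g t v d - t * w d = ∑ c, G α g c d * v c * w d := by
      intro v w
      rw [energy, mul_add, Finset.mul_sum, mul_comm t, add_sub_cancel_right]
      exact Finset.sum_congr rfl fun c _ => by ring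
    rw [h₁.mul_energyHat_eq, h₂.mul_energyHat_eq]
    have e3 : w₁ d * energy α g t v₁ d - w₂ d * energy α g t v₂ d - t * (w₁ d - w₂ d)
        = ∑ c, (G α g c d * v₁ c * w₁ d - G α g c d * v₂ c * w₂ d) := by
      rw [Finset.sum_sub_distrib, ← e, ← e]; ring
    rw [e3, Finset.sum_mul, Finset.mul_sum]
    refine Finset.sum_congr rfl fun c _ => ?_
    rw [mul_assoc (Ghat α g d c), ← mul_assoc (α c), alpha_mul_Ghat]
    ring
  have tnn : 0 ≤ ∑ c, α c * (t * ((w₁ c - w₂ c) * (Real.log (w₁ c) - Real.log (w₂ c)))) :=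
    Finset.sum_nonneg fun c _ => mul_nonneg (hα c).le
      (mul_nonneg ht (sub_mul_log_sub_log_nonneg (h₁.pos_hat c) (h₂.pos_hat c)))
  have hlog : ∀ {τ : ℝ} {v w : Fin D → ℝ}, 0 < τ → IsRealSolution α g τ t v w → ∀ c,
      Real.log (w c) - Real.log (energyHat α g t w c)
        = Real.log (weight α g τ t v w c) - Real.log τ := by
    intro τ v w hτ h c
    have h1 := congrArg Real.log (h.weight_mul_energyHat c)
    rw [Real.log_mul (h.weight_pos hα hg hτ ht c).ne' (h.energyHat_pos hα hg ht c).ne',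
      Real.log_mul hτ.ne' (h.pos_hat c).ne'] at h1
    linarith
  simp only [mul_sub (α _) (Finset.sum _ _), Finset.sum_sub_distrib] at tot
  rw [col] at tot
  have fin : (Real.log τ₁ - Real.log τ₂) * (meanWeight α g τ₁ t v₁ w₁ - meanWeight α g τ₂ t v₂ w₂)
      - ∑ c, α c * ((weight α g τ₁ t v₁ w₁ c - weight α g τ₂ t v₂ w₂ c) *
        (Real.log (weight α g τ₁ t v₁ w₁ c) - Real.log (weight α g τ₂ t v₂ w₂ c)))
      = ∑ c, α c * (((v₁ c * energyHat α g t w₁ c - v₂ c * energyHat α g t w₂ c)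
          - t * (w₁ c - w₂ c)) * (Real.log (w₁ c) - Real.log (w₂ c)))
        + ∑ c, α c * (t * ((w₁ c - w₂ c) * (Real.log (w₁ c) - Real.log (w₂ c))))
        - ∑ c, α c * ((v₁ c * energyHat α g t w₁ c - v₂ c * energyHat α g t w₂ c)
          * (Real.log (energyHat α g t w₁ c) - Real.log (energyHat α g t w₂ c))) := by
    rw [meanWeight, meanWeight, ← Finset.sum_sub_distrib, Finset.mul_sum,
      ← Finset.sum_sub_distrib, ← Finset.sum_add_distrib, ← Finset.sum_sub_distrib]
    refine Finset.sum_congr rfl fun c _ => ?_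
    rw [h₁.mul_energyHat hα hg hτ₁.le ht, h₂.mul_energyHat hα hg hτ₂.le ht]
    have l₁ := hlog hτ₁ h₁ c
    have l₂ := hlog hτ₂ h₂ c
    linear_combination (α c * (weight α g τ₁ t v₁ w₁ c - weight α g τ₂ t v₂ w₂ c)) * (l₁ - l₂)
  linarith

section Monotonicity

variable {τ₁ τ₂ t : ℝ} {v₁ w₁ v₂ w₂ : Fin D → ℝ}

lemma weight_term_nonneg (hα : ∀ c, 0 < α c) (hg : ∀ c d, 0 < g c d) (hτ₁ : 0 < τ₁)
    (hτ₂ : 0 < τ₂) (ht : 0 ≤ t) (h₁ : IsRealSolution α g τ₁ t v₁ w₁)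
    (h₂ : IsRealSolution α g τ₂ t v₂ w₂) (c : Fin D) :
    0 ≤ α c * ((weight α g τ₁ t v₁ w₁ c - weight α g τ₂ t v₂ w₂ c) *
      (Real.log (weight α g τ₁ t v₁ w₁ c) - Real.log (weight α g τ₂ t v₂ w₂ c))) :=
  mul_nonneg (hα c).le (sub_mul_log_sub_log_nonneg (h₁.weight_pos hα hg hτ₁ ht c)
    (h₂.weight_pos hα hg hτ₂ ht c))

lemma transition_term_nonneg (hα : ∀ c, 0 < α c) (hg : ∀ c d, 0 < g c d) (ht : 0 ≤ t)
    (h₁ : IsRealSolution α g τ₁ t v₁ w₁) (h₂ : IsRealSolution α g τ₂ t v₂ w₂) (c : Fin D) :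
    0 ≤ α c * ((v₁ c * energyHat α g t w₁ c + v₂ c * energyHat α g t w₂ c) *
      ∑ d, (√(transition α g t w₁ c d) - √(transition α g t w₂ c d)) ^ 2) := by
  have := h₁.energyHat_pos hα hg ht c
  have := h₂.energyHat_pos hα hg ht c
  have := h₁.pos c
  have := h₂.pos c
  have := hα c
  exact mul_nonneg (hα c).le (mul_nonneg (by positivity)
    (Finset.sum_nonneg fun d _ => sq_nonneg _))

/-- The case of equal `τ` at `t = 0` matters: there `(r v, w / r)` is a solution for every `r > 0`
whenever `(v, w)` is, so solutions are not unique, but the mean weight is. -/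
theorem meanWeight_mono (hα : ∀ c, 0 < α c) (hg : ∀ c d, 0 < g c d) (hτ₁ : 0 < τ₁)
    (hτ : τ₁ ≤ τ₂) (ht : 0 ≤ t) (h₁ : IsRealSolution α g τ₁ t v₁ w₁)
    (h₂ : IsRealSolution α g τ₂ t v₂ w₂) :
    meanWeight α g τ₁ t v₁ w₁ ≤ meanWeight α g τ₂ t v₂ w₂ := by
  have hτ₂ := hτ₁.trans_le hτ
  have key := log_sub_mul_meanWeight_sub hα hg hτ₁ hτ₂ ht h₁ h₂
  have n₁ := Finset.sum_nonneg fun c (_ : c ∈ Finset.univ) =>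
    weight_term_nonneg hα hg hτ₁ hτ₂ ht h₁ h₂ c
  have n₂ := Finset.sum_nonneg fun c (_ : c ∈ Finset.univ) =>
    transition_term_nonneg hα hg ht h₁ h₂ c
  rcases hτ.eq_or_lt with rfl | hlt
  · rw [sub_self, zero_mul] at key
    have z := (Finset.sum_eq_zero_iff_of_nonneg fun c _ =>
      weight_term_nonneg hα hg hτ₁ hτ₂ ht h₁ h₂ c).1 (by linarith)
    refine Finset.sum_le_sum fun c _ => le_of_eq ?_
    rw [eq_of_sub_mul_log_sub_log (h₁.weight_pos hα hg hτ₁ ht c) (h₂.weight_pos hα hg hτ₂ ht c)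
      ((mul_eq_zero.1 (z c (Finset.mem_univ c))).resolve_left (hα c).ne')]
  · by_contra! hc
    have := mul_neg_of_neg_of_pos (sub_neg.2 (Real.log_lt_log hτ₁ hlt)) (sub_pos.2 hc)
    linarith

/-- Equality annihilates every term of the entropy estimate: the weights `q_c` agree, and so do the
ratios `w_c / ŝ_c`. Then `τ = q_c ŝ_c / w_c` agrees as well. -/
theorem meanWeight_injective (hα : ∀ c, 0 < α c) (hg : ∀ c d, 0 < g c d) [Nonempty (Fin D)]
    (hτ₁ : 0 < τ₁) (hτ₂ : 0 < τ₂) (ht : 0 ≤ t) (h₁ : IsRealSolution α g τ₁ t v₁ w₁)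
    (h₂ : IsRealSolution α g τ₂ t v₂ w₂)
    (h : meanWeight α g τ₁ t v₁ w₁ = meanWeight α g τ₂ t v₂ w₂) : τ₁ = τ₂ := by
  have key := log_sub_mul_meanWeight_sub hα hg hτ₁ hτ₂ ht h₁ h₂
  rw [h, sub_self, mul_zero] at key
  have n₁ := Finset.sum_nonneg fun c (_ : c ∈ Finset.univ) =>
    weight_term_nonneg hα hg hτ₁ hτ₂ ht h₁ h₂ c
  have n₂ := Finset.sum_nonneg fun c (_ : c ∈ Finset.univ) =>
    transition_term_nonneg hα hg ht h₁ h₂ c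
  obtain ⟨c⟩ := ‹Nonempty (Fin D)›
  have z₁ := (Finset.sum_eq_zero_iff_of_nonneg fun c _ =>
    weight_term_nonneg hα hg hτ₁ hτ₂ ht h₁ h₂ c).1 (by linarith) c (Finset.mem_univ c)
  have z₂ := (Finset.sum_eq_zero_iff_of_nonneg fun c _ =>
    transition_term_nonneg hα hg ht h₁ h₂ c).1 (by linarith) c (Finset.mem_univ c)
  have hq := eq_of_sub_mul_log_sub_log (h₁.weight_pos hα hg hτ₁ ht c)
    (h₂.weight_pos hα hg hτ₂ ht c) ((mul_eq_zero.1 z₁).resolve_left (hα c).ne')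
  have hσ₁ := h₁.energyHat_pos hα hg ht c
  have hσ₂ := h₂.energyHat_pos hα hg ht c
  have hfac : 0 < v₁ c * energyHat α g t w₁ c + v₂ c * energyHat α g t w₂ c :=
    add_pos (mul_pos (h₁.pos c) hσ₁) (mul_pos (h₂.pos c) hσ₂)
  have z₃ := (Finset.sum_eq_zero_iff_of_nonneg fun d _ => sq_nonneg _).1
    ((mul_eq_zero.1 ((mul_eq_zero.1 z₂).resolve_left (hα c).ne')).resolve_left hfac.ne') c
    (Finset.mem_univ c)
  have hGc : 0 < Ghat α g c c := mul_pos (hα c) (pow_pos (hg c c) 2)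
  have hκ : transition α g t w₁ c c = transition α g t w₂ c c := by
    have p₁ : 0 ≤ transition α g t w₁ c c :=
      div_nonneg (mul_nonneg hGc.le (h₁.pos_hat c).le) hσ₁.le
    have p₂ : 0 ≤ transition α g t w₂ c c :=
      div_nonneg (mul_nonneg hGc.le (h₂.pos_hat c).le) hσ₂.le
    exact (Real.sqrt_inj p₁ p₂).1 (sub_eq_zero.1 (pow_eq_zero_iff two_ne_zero |>.1 z₃))
  rw [transition, transition, div_eq_div_iff hσ₁.ne' hσ₂.ne'] at hκ
  have hw : w₁ c * energyHat α g t w₂ c = w₂ c * energyHat α g t w₁ c :=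
    mul_left_cancel₀ hGc.ne' (by linarith)
  have e₁ := h₁.weight_mul_energyHat c
  have e₂ := h₂.weight_mul_energyHat c
  rw [hq] at e₁
  refine mul_right_cancel₀ (mul_pos (h₁.pos_hat c) hσ₂).ne' ?_
  linear_combination (-energyHat α g t w₂ c) * e₁ + energyHat α g t w₁ c * e₂ - τ₂ * hw

end Monotonicity

/-! ### Behaviour of the solutions as `t → 0` -/

lemma exists_sq_bounds [Nonempty (Fin D)] (hg : ∀ c d, 0 < g c d) :
    ∃ m M : ℝ, 0 < m ∧ 0 < M ∧ (∀ c d, m ≤ g c d ^ 2) ∧ ∀ c d, g c d ^ 2 ≤ M := by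
  obtain ⟨i, -, hi⟩ := Finset.exists_min_image Finset.univ
    (fun p : Fin D × Fin D => g p.1 p.2 ^ 2) Finset.univ_nonempty
  obtain ⟨j, -, hj⟩ := Finset.exists_max_image Finset.univ
    (fun p : Fin D × Fin D => g p.1 p.2 ^ 2) Finset.univ_nonempty
  exact ⟨_, _, pow_pos (hg i.1 i.2) 2, pow_pos (hg j.1 j.2) 2,
    fun c d => hi (c, d) (Finset.mem_univ _), fun c d => hj (c, d) (Finset.mem_univ _)⟩

lemma energy_mono_sum {k : Fin D → ℝ} {v : Fin D → ℝ} {m M : ℝ} (hα : ∀ c, 0 < α c)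
    (hv : ∀ c, 0 < v c) (hm : ∀ d, m ≤ k d) (hM : ∀ d, k d ≤ M) :
    m * ∑ d, α d * v d ≤ ∑ d, α d * k d * v d ∧ ∑ d, α d * k d * v d ≤ M * ∑ d, α d * v d := by
  rw [Finset.mul_sum, Finset.mul_sum]
  constructor <;> refine Finset.sum_le_sum fun d _ => ?_
  · have := mul_le_mul_of_nonneg_right (hm d) (mul_pos (hα d) (hv d)).le
    linarith
  · have := mul_le_mul_of_nonneg_right (hM d) (mul_pos (hα d) (hv d)).le
    linarith

namespace IsRealSolution

variable {τ t m M : ℝ} {v w : Fin D → ℝ}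

lemma le_energy (h : IsRealSolution α g τ t v w) (hα : ∀ c, 0 < α c) (ht : 0 < t)
    (hm : ∀ c d, m ≤ g c d ^ 2) (c : Fin D) : m * ∑ d, α d * v d ≤ energy α g t v c :=
  -- Only the lower bound is used; the column sum merely supplies some admissible upper bound.
  ((energy_mono_sum hα h.pos (fun d => hm d c) (M := ∑ d, g d c ^ 2) (fun d =>
    Finset.single_le_sum (f := fun d => g d c ^ 2) (fun _ _ => sq_nonneg _)
      (Finset.mem_univ d))).1).trans (le_add_of_nonneg_right ht.le)

lemma le_energyHat (h : IsRealSolution α g τ t v w) (hα : ∀ c, 0 < α c) (ht : 0 < t)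
    (hm : ∀ c d, m ≤ g c d ^ 2) (c : Fin D) : m * ∑ d, α d * v d ≤ energyHat α g t w c := by
  rw [h.sum_eq_sum_hat ht]
  exact ((energy_mono_sum hα h.pos_hat (fun d => hm c d) (M := ∑ d, g c d ^ 2) (fun d =>
    Finset.single_le_sum (f := fun d => g c d ^ 2) (fun _ _ => sq_nonneg _)
      (Finset.mem_univ d))).1).trans (le_add_of_nonneg_right ht.le)

lemma energy_le (h : IsRealSolution α g τ t v w) (hα : ∀ c, 0 < α c)
    (hM : ∀ c d, g c d ^ 2 ≤ M) (c : Fin D) : energy α g t v c ≤ M * ∑ d, α d * v d + t :=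
  add_le_add_left (energy_mono_sum hα h.pos (fun _ => sq_nonneg _) (fun d => hM d c)).2 t

lemma energyHat_le (h : IsRealSolution α g τ t v w) (hα : ∀ c, 0 < α c) (ht : 0 < t)
    (hM : ∀ c d, g c d ^ 2 ≤ M) (c : Fin D) :
    energyHat α g t w c ≤ M * ∑ d, α d * v d + t := by
  rw [h.sum_eq_sum_hat ht]
  exact add_le_add_left
    (energy_mono_sum hα h.pos_hat (fun _ => sq_nonneg _) (fun d => hM c d)).2 t

lemma sum_pos [Nonempty (Fin D)] (h : IsRealSolution α g τ t v w) (hα : ∀ c, 0 < α c) :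
    0 < ∑ c, α c * v c :=
  Finset.sum_pos (fun c _ => mul_pos (hα c) (h.pos c)) Finset.univ_nonempty

/-- Since `v_c ŝ_c = 1 - q_c ≤ 1` and `ŝ_c` is at least `m` times the mean of `v`, averaging over
`c` bounds the square of that mean. -/
lemma mul_sq_sum_le (h : IsRealSolution α g τ t v w) (hα : ∀ c, 0 < α c)
    (hsum : ∑ c, α c = 1) (hg : ∀ c d, 0 < g c d) (hτ : 0 ≤ τ) (ht : 0 < t)
    (hm : ∀ c d, m ≤ g c d ^ 2) : m * (∑ c, α c * v c) ^ 2 ≤ 1 := by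
  have h1 : ∀ c, v c * (m * ∑ d, α d * v d) ≤ 1 := fun c => by
    have h2 := mul_le_mul_of_nonneg_left (h.le_energyHat hα ht hm c) (h.pos c).le
    rw [h.mul_energyHat hα hg hτ ht.le] at h2
    linarith [h.weight_nonneg hα hg hτ ht.le c]
  calc m * (∑ c, α c * v c) ^ 2 = ∑ c, α c * (v c * (m * ∑ d, α d * v d)) := by
        simp only [← mul_assoc, ← Finset.sum_mul]; ring
    _ ≤ ∑ c, α c * 1 := Finset.sum_le_sum fun c _ => mul_le_mul_of_nonneg_left (h1 c) (hα c).le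
    _ = 1 := by simpa using hsum

/-- Pairing the equation with the right Perron eigenvector of `G`. -/
lemma perron_pairing (h : IsRealSolution α g τ t v w) (hα : ∀ c, 0 < α c)
    (hg : ∀ c d, 0 < g c d) (hτ : 0 ≤ τ) (ht : 0 ≤ t) {k : ℝ} {x : Fin D → ℝ}
    (hx : ∀ c, ∑ d, G α g c d * x d = k * x c) :
    ∑ c, x c * v c * (τ - k + energyHat α g t w c * energy α g t v c) = t * ∑ c, x c := by
  have h1 : ∀ c, x c * v c * (τ + energyHat α g t w c * energy α g t v c)
      = x c * energy α g t v c := fun c => by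
    have := (h.denom_pos hα hg hτ ht c).ne'
    have h2 := h.eq c
    rw [eq_div_iff this] at h2
    rw [mul_assoc, h2]
  have h2 : ∑ c, x c * energy α g t v c = k * ∑ c, x c * v c + t * ∑ c, x c := by
    simp only [energy, mul_add, Finset.sum_add_distrib, Finset.mul_sum]
    congr 1
    · rw [Finset.sum_comm]
      refine Finset.sum_congr rfl fun d _ => ?_
      rw [← mul_assoc, ← hx d, Finset.sum_mul]
      exact Finset.sum_congr rfl fun c _ => by ring
    · exact Finset.sum_congr rfl fun c _ => by ring
  rw [← Finset.sum_congr rfl fun c _ => h1 c] at h2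
  have h3 : ∑ c, x c * v c * (τ - k + energyHat α g t w c * energy α g t v c)
      = ∑ c, x c * v c * (τ + energyHat α g t w c * energy α g t v c) - k * ∑ c, x c * v c := by
    rw [Finset.mul_sum, ← Finset.sum_sub_distrib]
    exact Finset.sum_congr rfl fun c _ => by ring
  rw [h3, h2]; ring

/-- The Perron pairing has a positive sum, so some factor `τ - λ + ŝ_c s_c` is positive; both
energies there are at most `M` times the mean of `v` plus `t`. -/
lemma sqrt_le_of_lt_perronEigenvalue [Nonempty (Fin D)] (h : IsRealSolution α g τ t v w)
    (hα : ∀ c, 0 < α c) (hg : ∀ c d, 0 < g c d) (hτ : 0 ≤ τ) (ht : 0 < t) (hM0 : 0 < M)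
    (hM : ∀ c d, g c d ^ 2 ≤ M) :
    √(perronEigenvalue α g - τ) ≤ M * ∑ c, α c * v c + t := by
  obtain ⟨-, x, hx, hxe⟩ := perronEigenvalue_spec hα hg
  have hp := h.perron_pairing hα hg hτ ht.le hxe
  have hpos : 0 < t * ∑ c, x c :=
    mul_pos ht (Finset.sum_pos (fun c _ => hx c) Finset.univ_nonempty)
  rw [← hp] at hpos
  obtain ⟨c, -, hc⟩ := Finset.exists_lt_of_sum_lt
    (show ∑ c : Fin D, (0 : ℝ) < _ by simpa using hpos)
  have hc' := pos_of_mul_pos_right hc (mul_pos (hx c) (h.pos c)).le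
  have hb : 0 ≤ M * ∑ c, α c * v c + t := by have := h.sum_pos hα; positivity
  refine Real.sqrt_le_iff.2 ⟨hb, ?_⟩
  have := mul_le_mul (h.energyHat_le hα ht hM c) (h.energy_le hα hM c)
    (h.energy_pos hα hg ht.le c).le hb
  rw [pow_two]
  linarith

end IsRealSolution

lemma tendsto_energy {ι : Type*} {l : Filter ι} {T : ι → ℝ} {V : ι → Fin D → ℝ} {t : ℝ}
    {v : Fin D → ℝ} (hT : Tendsto T l (𝓝 t)) (hV : Tendsto V l (𝓝 v)) (c : Fin D) :
    Tendsto (fun i => energy α g (T i) (V i) c) l (𝓝 (energy α g t v c)) :=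
  (tendsto_finsetSum _ fun d _ => (tendsto_pi_nhds.1 hV d).const_mul _).add hT

lemma tendsto_energyHat {ι : Type*} {l : Filter ι} {T : ι → ℝ} {W : ι → Fin D → ℝ} {t : ℝ}
    {w : Fin D → ℝ} (hT : Tendsto T l (𝓝 t)) (hW : Tendsto W l (𝓝 w)) (c : Fin D) :
    Tendsto (fun i => energyHat α g (T i) (W i) c) l (𝓝 (energyHat α g t w c)) :=
  (tendsto_finsetSum _ fun d _ => (tendsto_pi_nhds.1 hW d).const_mul _).add hT

lemma tendsto_meanWeight {ι : Type*} {l : Filter ι} {T : ι → ℝ} {V W : ι → Fin D → ℝ} {τ t : ℝ}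
    {v w : Fin D → ℝ} (hT : Tendsto T l (𝓝 t)) (hV : Tendsto V l (𝓝 v)) (hW : Tendsto W l (𝓝 w))
    (h0 : ∀ c, τ + energyHat α g t w c * energy α g t v c ≠ 0) :
    Tendsto (fun i => meanWeight α g τ (T i) (V i) (W i)) l (𝓝 (meanWeight α g τ t v w)) :=
  tendsto_finsetSum _ fun c _ => (tendsto_const_nhds.div (tendsto_const_nhds.add
    ((tendsto_energyHat hT hW c).mul (tendsto_energy hT hV c))) (h0 c)).const_mul _

section Limits

variable {τ : ℝ} {V W : ℝ → Fin D → ℝ}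

/-- Outside the disk each term of the Perron pairing is nonnegative and bounded by the right side,
which is linear in `t`; hence `v = O(t)`. The bound passes to `w` through the equality of the two
`α`-means. -/
theorem tendsto_zero_of_perronEigenvalue_lt [Nonempty (Fin D)] (hα : ∀ c, 0 < α c)
    (hg : ∀ c d, 0 < g c d) (hτ : perronEigenvalue α g < τ)
    (h : ∀ t, 0 < t → IsRealSolution α g τ t (V t) (W t)) :
    Tendsto V (𝓝[>] 0) (𝓝 0) ∧ Tendsto W (𝓝[>] 0) (𝓝 0) := by
  obtain ⟨hl, x, hx, hxe⟩ := perronEigenvalue_spec hα hg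
  have hid : Tendsto (fun t : ℝ => t) (𝓝[>] 0) (𝓝 0) := tendsto_nhdsWithin_of_tendsto_nhds tendsto_id
  have hpos : ∀ᶠ t : ℝ in 𝓝[>] 0, 0 < t := eventually_mem_nhdsWithin
  have hV : ∀ c, Tendsto (fun t => V t c) (𝓝[>] 0) (𝓝 0) := by
    intro c
    have hb : Tendsto (fun t : ℝ => t * ((∑ c, x c) / (x c * (τ - perronEigenvalue α g))))
        (𝓝[>] 0) (𝓝 0) := by
      simpa using hid.mul_const ((∑ c, x c) / (x c * (τ - perronEigenvalue α g)))
    refine tendsto_of_tendsto_of_tendsto_of_le_of_le' tendsto_const_nhds hb ?_ ?_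
    · filter_upwards [hpos] with t ht using ((h t ht).pos c).le
    · filter_upwards [hpos] with t ht
      have hs := h t ht
      have hp := hs.perron_pairing hα hg (hl.trans hτ).le ht.le hxe
      have hterm : ∀ d, x d * V t d * (τ - perronEigenvalue α g) ≤ x d * V t d *
          (τ - perronEigenvalue α g + energyHat α g t (W t) d * energy α g t (V t) d) := fun d =>
        mul_le_mul_of_nonneg_left (le_add_of_nonneg_right (mul_pos
          (hs.energyHat_pos hα hg ht.le d) (hs.energy_pos hα hg ht.le d)).le)
          (mul_pos (hx d) (hs.pos d)).le
      have hdiff := sub_pos.2 hτ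
      have h1 := Finset.single_le_sum (f := fun d => x d * V t d *
          (τ - perronEigenvalue α g + energyHat α g t (W t) d * energy α g t (V t) d))
        (fun d _ => le_trans (mul_pos (mul_pos (hx d) (hs.pos d)) hdiff).le (hterm d))
        (Finset.mem_univ c)
      rw [hp] at h1
      have h2 := (hterm c).trans h1
      rw [← mul_div_assoc, le_div_iff₀ (mul_pos (hx c) hdiff)]
      linarith
  have hS : Tendsto (fun t => ∑ c, α c * V t c) (𝓝[>] 0) (𝓝 0) := by
    simpa using tendsto_finsetSum Finset.univ fun c _ => (hV c).const_mul (α c)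
  refine ⟨tendsto_pi_nhds.2 hV, tendsto_pi_nhds.2 fun c => ?_⟩
  have hb : Tendsto (fun t => (∑ c, α c * V t c) / α c) (𝓝[>] 0) (𝓝 0) := by
    simpa using hS.div_const (α c)
  refine tendsto_of_tendsto_of_tendsto_of_le_of_le' tendsto_const_nhds hb ?_ ?_
  · filter_upwards [hpos] with t ht using ((h t ht).pos_hat c).le
  · filter_upwards [hpos] with t ht
    have hs := h t ht
    rw [le_div_iff₀ (hα c), hs.sum_eq_sum_hat ht, mul_comm]
    exact Finset.single_le_sum (f := fun d => α d * W t d)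
      (fun d _ => (mul_pos (hα d) (hs.pos_hat d)).le) (Finset.mem_univ c)

theorem tendsto_meanWeight_one [Nonempty (Fin D)] (hα : ∀ c, 0 < α c) (hsum : ∑ c, α c = 1)
    (hg : ∀ c d, 0 < g c d) (hτ : perronEigenvalue α g < τ)
    (h : ∀ t, 0 < t → IsRealSolution α g τ t (V t) (W t)) :
    Tendsto (fun t => meanWeight α g τ t (V t) (W t)) (𝓝[>] 0) (𝓝 1) := by
  obtain ⟨hV, hW⟩ := tendsto_zero_of_perronEigenvalue_lt hα hg hτ h
  have hτ0 : 0 < τ := (perronEigenvalue_spec hα hg).1.trans hτ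
  have e : ∀ c, τ + energyHat α g 0 0 c * energy α g 0 0 c = τ := fun c => by
    simp [energy, energyHat]
  have := tendsto_meanWeight (α := α) (g := g) (τ := τ)
    (tendsto_nhdsWithin_of_tendsto_nhds tendsto_id : Tendsto (fun t : ℝ => t) (𝓝[>] 0) (𝓝 0)) hV hW
    (fun c => by rw [e]; exact hτ0.ne')
  convert this using 2
  simp only [meanWeight, weight, e, div_self hτ0.ne', mul_one, hsum]

theorem eventually_sum_ge [Nonempty (Fin D)] (hα : ∀ c, 0 < α c) (hg : ∀ c d, 0 < g c d)
    (hτ0 : 0 ≤ τ) (hτ : τ < perronEigenvalue α g)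
    (h : ∀ t, 0 < t → IsRealSolution α g τ t (V t) (W t)) :
    ∃ C : ℝ, 0 < C ∧ ∀ᶠ t in 𝓝[>] (0 : ℝ), C ≤ ∑ c, α c * V t c := by
  obtain ⟨m, M, hm0, hM0, hm, hM⟩ := exists_sq_bounds hg
  have hd : 0 < √(perronEigenvalue α g - τ) := Real.sqrt_pos.2 (sub_pos.2 hτ)
  -- For `t` below half the square root, at least the other half remains for `M` times the mean.
  refine ⟨√(perronEigenvalue α g - τ) / 2 / M, by positivity, ?_⟩
  filter_upwards [Ioo_mem_nhdsGT (half_pos hd)] with t ht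
  have := (h t ht.1).sqrt_le_of_lt_perronEigenvalue hα hg hτ0 ht.1 hM0 hM
  rw [div_le_iff₀ hM0]
  linarith [ht.2]

theorem exists_limit_of_ultrafilter [Nonempty (Fin D)] (hα : ∀ c, 0 < α c)
    (hsum : ∑ c, α c = 1) (hg : ∀ c d, 0 < g c d) (hτ0 : 0 < τ) (hτ : τ < perronEigenvalue α g)
    (h : ∀ t, 0 < t → IsRealSolution α g τ t (V t) (W t)) (U : Ultrafilter ℝ)
    (hU : (U : Filter ℝ) ≤ 𝓝[>] 0) :
    ∃ v w, IsRealSolution α g τ 0 v w ∧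
      Tendsto (fun t => meanWeight α g τ t (V t) (W t)) U (𝓝 (meanWeight α g τ 0 v w)) := by
  obtain ⟨m, M, hm0, hM0, hm, hM⟩ := exists_sq_bounds hg
  obtain ⟨C, hC, hev⟩ := eventually_sum_ge hα hg hτ0.le hτ h
  -- `X` bounds the mean of `v`, `B` bounds both energies when `t < 1`, and `δ` bounds the quotients
  -- defining `v` and `w` from below. The lower bound keeps limit points strictly positive.
  set X := √(1 / m)
  set B := M * X + 1
  have hB : 0 < B := by positivity
  set δ := m * C / (τ + B * B)
  have hδ : 0 < δ := by positivity
  have hid : Tendsto (fun t : ℝ => t) (𝓝[>] 0) (𝓝 0) := tendsto_nhdsWithin_of_tendsto_nhds tendsto_id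
  let K : Set ((Fin D → ℝ) × (Fin D → ℝ)) :=
    (Set.univ.pi fun c => Set.Icc δ (X / α c)) ×ˢ (Set.univ.pi fun c => Set.Icc δ (X / α c))
  have hK : IsCompact K := (isCompact_univ_pi fun c => isCompact_Icc).prod
    (isCompact_univ_pi fun c => isCompact_Icc)
  have hmem : ∀ᶠ t in 𝓝[>] (0 : ℝ), (V t, W t) ∈ K := by
    filter_upwards [hev, Ioo_mem_nhdsGT (zero_lt_one' ℝ)] with t htC ht
    have hs := h t ht.1
    have hxX : ∑ c, α c * V t c ≤ X := by
      refine Real.le_sqrt_of_sq_le ?_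
      rw [le_div_iff₀ hm0, mul_comm]
      exact hs.mul_sq_sum_le hα hsum hg hτ0.le ht.1 hm
    have hMx : M * ∑ c, α c * V t c + t ≤ B :=
      add_le_add (mul_le_mul_of_nonneg_left hxX hM0.le) ht.2.le
    have hden : ∀ c, τ + energyHat α g t (W t) c * energy α g t (V t) c ≤ τ + B * B := fun c =>
      add_le_add_right (mul_le_mul ((hs.energyHat_le hα ht.1 hM c).trans hMx)
        ((hs.energy_le hα hM c).trans hMx) (hs.energy_pos hα hg ht.1.le c).le hB.le) τ
    have hmC : m * C ≤ m * ∑ c, α c * V t c := mul_le_mul_of_nonneg_left htC hm0.le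
    refine ⟨fun c _ => ⟨?_, ?_⟩, fun c _ => ⟨?_, ?_⟩⟩
    · simp only
      rw [hs.eq c]
      exact div_le_div₀ (hs.energy_pos hα hg ht.1.le c).le
        (hmC.trans (hs.le_energy hα ht.1 hm c)) (hs.denom_pos hα hg hτ0.le ht.1.le c) (hden c)
    · simp only
      rw [le_div_iff₀ (hα c), mul_comm]
      exact (Finset.single_le_sum (f := fun d => α d * V t d)
        (fun d _ => (mul_pos (hα d) (hs.pos d)).le) (Finset.mem_univ c)).trans hxX
    · simp only
      rw [hs.eq_hat c]
      exact div_le_div₀ (hs.energyHat_pos hα hg ht.1.le c).le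
        (hmC.trans (hs.le_energyHat hα ht.1 hm c)) (hs.denom_pos hα hg hτ0.le ht.1.le c) (hden c)
    · simp only
      rw [le_div_iff₀ (hα c), mul_comm]
      rw [hs.sum_eq_sum_hat ht.1] at hxX
      exact (Finset.single_le_sum (f := fun d => α d * W t d)
        (fun d _ => (mul_pos (hα d) (hs.pos_hat d)).le) (Finset.mem_univ c)).trans hxX
  obtain ⟨⟨v, w⟩, hvw, hlim⟩ := hK.ultrafilter_le_nhds (U.map fun t => (V t, W t))
    (le_principal_iff.2 (hU hmem))
  have hlim' : Tendsto (fun t => (V t, W t)) U (𝓝 (v, w)) := hlim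
  have hV : Tendsto V U (𝓝 v) := (continuous_fst.tendsto _).comp hlim'
  have hW : Tendsto W U (𝓝 w) := (continuous_snd.tendsto _).comp hlim'
  have hv : ∀ c, 0 < v c := fun c => hδ.trans_le (hvw.1 c trivial).1
  have hw : ∀ c, 0 < w c := fun c => hδ.trans_le (hvw.2 c trivial).1
  have hden : ∀ c, τ + energyHat α g 0 w c * energy α g 0 v c ≠ 0 := fun c =>
    (add_pos hτ0 (mul_pos (energyHat_pos hα hg le_rfl hw c) (energy_pos hα hg le_rfl hv c))).ne'
  have hT : Tendsto (fun t : ℝ => t) U (𝓝 0) := hid.mono_left hU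
  have hpos : ∀ᶠ t : ℝ in U, 0 < t := hU eventually_mem_nhdsWithin
  have lden : ∀ c, Tendsto (fun t => τ + energyHat α g t (W t) c * energy α g t (V t) c) U
      (𝓝 (τ + energyHat α g 0 w c * energy α g 0 v c)) := fun c =>
    tendsto_const_nhds.add ((tendsto_energyHat hT hW c).mul (tendsto_energy hT hV c))
  refine ⟨v, w, ⟨hv, hw, fun c => ?_, fun c => ?_⟩, tendsto_meanWeight hT hV hW hden⟩
  · refine tendsto_nhds_unique (tendsto_pi_nhds.1 hV c)
      (((tendsto_energy hT hV c).div (lden c) (hden c)).congr' ?_)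
    filter_upwards [hpos] with t ht using ((h t ht).eq c).symm
  · refine tendsto_nhds_unique (tendsto_pi_nhds.1 hW c)
      (((tendsto_energyHat hT hW c).div (lden c) (hden c)).congr' ?_)
    filter_upwards [hpos] with t ht using ((h t ht).eq_hat c).symm

/-- Limit points of `(v, w)` along different ultrafilters may differ, but they all solve the
equations at `t = 0` and so share one mean weight. This gives convergence of the mean weight only.
-/
theorem exists_tendsto_meanWeight [Nonempty (Fin D)] (hα : ∀ c, 0 < α c)
    (hsum : ∑ c, α c = 1) (hg : ∀ c d, 0 < g c d) (hτ0 : 0 < τ) (hτ : τ < perronEigenvalue α g)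
    (h : ∀ t, 0 < t → IsRealSolution α g τ t (V t) (W t)) :
    ∃ v w, IsRealSolution α g τ 0 v w ∧
      Tendsto (fun t => meanWeight α g τ t (V t) (W t)) (𝓝[>] 0)
        (𝓝 (meanWeight α g τ 0 v w)) := by
  obtain ⟨v, w, hvw, -⟩ := exists_limit_of_ultrafilter hα hsum hg hτ0 hτ h
    (Ultrafilter.of (𝓝[>] 0)) (Ultrafilter.of_le _)
  refine ⟨v, w, hvw, tendsto_iff_ultrafilter _ _ _ |>.2 fun U hU => ?_⟩
  obtain ⟨v', w', hvw', hlim⟩ := exists_limit_of_ultrafilter hα hsum hg hτ0 hτ h U hU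
  rwa [(meanWeight_mono hα hg hτ0 le_rfl le_rfl hvw hvw').antisymm
    (meanWeight_mono hα hg hτ0 le_rfl le_rfl hvw' hvw)]

end Limits

/-! ### Rotation invariant measures and their radial distribution functions -/

/-- Integration by parts against a Stieltjes measure. -/
theorem integral_stieltjes_eq_neg_integral_mul_deriv (F : StieltjesFunction ℝ)
    [IsFiniteMeasure F.measure] (hF : Tendsto F atBot (𝓝 0)) {ψ : ℝ → ℂ} (hψ : ContDiff ℝ 1 ψ)
    (hc : HasCompactSupport ψ) :
    ∫ x, ψ x ∂F.measure = -∫ u, (F u : ℂ) * deriv ψ u := by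
  have hd : Integrable (deriv ψ) :=
    (hψ.continuous_deriv le_rfl).integrable_of_hasCompactSupport hc.deriv
  have hF0 : ∀ u, 0 ≤ F u := fun u => F.mono.le_of_tendsto hF u
  -- Writing `ψ` as minus the integral of its derivative over `[x, ∞)` reduces the claim to Fubini:
  -- for fixed `u` the inner measure is that of `(-∞, u]`, namely `F u`.
  have e1 : ∀ x, ψ x = -∫ u, (Set.Ici x).indicator (deriv ψ) u := fun x => by
    rw [integral_indicator measurableSet_Ici, integral_Ici_eq_integral_Ioi,
      hc.integral_Ioi_deriv_eq hψ, neg_neg]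
  have hInt : Integrable (Function.uncurry fun x u => (Set.Ici x).indicator (deriv ψ) u)
      (F.measure.prod volume) := by
    have h1 : Integrable (fun p : ℝ × ℝ => deriv ψ p.2) (F.measure.prod volume) := hd.comp_snd _
    have h2 : (Function.uncurry fun x u => (Set.Ici x).indicator (deriv ψ) u)
        = {p : ℝ × ℝ | p.1 ≤ p.2}.indicator fun p => deriv ψ p.2 := by
      ext ⟨x, u⟩
      simp [Set.indicator_apply, Function.uncurry]
    rw [h2]
    exact h1.indicator (measurableSet_le measurable_fst measurable_snd)
  calc ∫ x, ψ x ∂F.measure = -∫ x, (∫ u, (Set.Ici x).indicator (deriv ψ) u) ∂F.measure := by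
        rw [← integral_neg]
        exact integral_congr_ae (Eventually.of_forall e1)
    _ = -∫ u, ∫ x, (Set.Ici x).indicator (deriv ψ) u ∂F.measure := by
        rw [integral_integral_swap hInt]
    _ = -∫ u, (F u : ℂ) * deriv ψ u := by
        congr 2
        ext u
        have h3 : (fun x => (Set.Ici x).indicator (deriv ψ) u)
            = (Set.Iic u).indicator fun _ => deriv ψ u := by
          ext x
          simp [Set.indicator_apply]
        rw [h3, integral_indicator measurableSet_Iic, setIntegral_const, measureReal_def,
          F.measure_Iic hF, sub_zero, ENNReal.toReal_ofReal (hF0 u), Complex.real_smul]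

/-- The point with polar coordinates `p`. -/
noncomputable def polarPoint (p : ℝ × ℝ) : ℂ := p.1 * Complex.exp (p.2 * Complex.I)

/-- The derivative of `φ` in the direction of the radius. -/
noncomputable def radialDeriv (φ : ℂ → ℂ) (p : ℝ × ℝ) : ℂ :=
  fderiv ℝ φ (polarPoint p) (Complex.exp (p.2 * Complex.I))

/-- The derivative of `φ` orthogonally to the radius. -/
noncomputable def angularDeriv (φ : ℂ → ℂ) (p : ℝ × ℝ) : ℂ :=
  fderiv ℝ φ (polarPoint p) (Complex.I * Complex.exp (p.2 * Complex.I))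

lemma continuous_polarPoint : Continuous polarPoint := by
  unfold polarPoint; fun_prop

lemma norm_polarPoint (p : ℝ × ℝ) : ‖polarPoint p‖ = |p.1| := by
  rw [polarPoint, norm_mul, Complex.norm_exp_ofReal_mul_I, mul_one, Complex.norm_real,
    Real.norm_eq_abs]

lemma polarCoord_symm_eq (p : ℝ × ℝ) : Complex.polarCoord.symm p = polarPoint p := by
  rw [Complex.polarCoord_symm_apply, polarPoint, Complex.exp_mul_I, Complex.ofReal_cos,
    Complex.ofReal_sin]

/-- The polar form of `∂_z`. Here `angularDeriv` is `r⁻¹ ∂_θ`, so nothing is singular at the origin.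
-/
lemma exp_mul_wirtinger (φ : ℂ → ℂ) (p : ℝ × ℝ) :
    Complex.exp (p.2 * Complex.I) * wirtinger φ (polarPoint p)
      = (1 / 2) * (radialDeriv φ p - Complex.I * angularDeriv φ p) := by
  rw [wirtinger, radialDeriv, angularDeriv]
  set L := fderiv ℝ φ (polarPoint p)
  have e1 : Complex.exp (p.2 * Complex.I)
      = Real.cos p.2 • (1 : ℂ) + Real.sin p.2 • Complex.I := by
    rw [Complex.exp_mul_I]
    simp
  have e2 : Complex.I * Complex.exp (p.2 * Complex.I)
      = Real.cos p.2 • Complex.I - Real.sin p.2 • (1 : ℂ) := by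
    rw [e1]
    simp only [Complex.real_smul]
    linear_combination (Real.sin p.2 : ℂ) * Complex.I_mul_I
  have l1 : L (Complex.exp (p.2 * Complex.I)) = Real.cos p.2 * L 1 + Real.sin p.2 * L Complex.I := by
    rw [e1, map_add, map_smul, map_smul, Complex.real_smul, Complex.real_smul]
  have l2 : L (Complex.I * Complex.exp (p.2 * Complex.I))
      = Real.cos p.2 * L Complex.I - Real.sin p.2 * L 1 := by
    rw [e2, map_sub, map_smul, map_smul, Complex.real_smul, Complex.real_smul]
  rw [l1, l2, e1]
  simp only [Complex.real_smul]
  linear_combination (-(1 / 2) * (Real.sin p.2 : ℂ) * L Complex.I) * Complex.I_mul_I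

/-- The pairing of `-(z / |z|²) k(|z|)` with `∂_z φ` in polar coordinates. -/
theorem integral_radial_mul_wirtinger (k : ℝ → ℝ) (φ : ℂ → ℂ) :
    ∫ z : ℂ, (-z / (‖z‖ : ℂ) ^ 2 * (k ‖z‖ : ℂ)) * wirtinger φ z
      = -(1 / 2) * ∫ p in polarCoord.target, (k p.1 : ℂ) *
        (radialDeriv φ p - Complex.I * angularDeriv φ p) := by
  rw [← Complex.integral_comp_polarCoord_symm, ← integral_const_mul]
  refine setIntegral_congr_fun polarCoord.open_target.measurableSet fun p hp => ?_
  have hp0 : 0 < p.1 := hp.1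
  have hp' : (p.1 : ℂ) ≠ 0 := by exact_mod_cast hp0.ne'
  simp only [polarCoord_symm_eq, norm_polarPoint, abs_of_pos hp0, Complex.real_smul]
  -- The Jacobian `r` cancels the singularity `1 / r` of `z / |z|²`.
  have e : (p.1 : ℂ) * ((-polarPoint p / (p.1 : ℂ) ^ 2 * (k p.1 : ℂ)) * wirtinger φ (polarPoint p))
      = -(k p.1 : ℂ) * (Complex.exp (p.2 * Complex.I) * wirtinger φ (polarPoint p)) := by
    rw [show -polarPoint p / (p.1 : ℂ) ^ 2 = -Complex.exp (p.2 * Complex.I) / p.1 by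
      rw [polarPoint]; field_simp]
    field_simp
  rw [e, exp_mul_wirtinger]
  ring

section TestFunction

variable {φ : ℂ → ℂ}

lemma continuous_radialDeriv (hφ : ContDiff ℝ ∞ φ) : Continuous (radialDeriv φ) := by
  have := hφ.continuous_fderiv (by simp)
  exact (this.comp continuous_polarPoint).clm_apply (by fun_prop)

lemma continuous_angularDeriv (hφ : ContDiff ℝ ∞ φ) : Continuous (angularDeriv φ) := by
  have := hφ.continuous_fderiv (by simp)
  exact (this.comp continuous_polarPoint).clm_apply (by fun_prop)

/-- The derivatives of a test function are dominated by an integrable function of the radius. -/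
lemma exists_deriv_bound (hφ : ContDiff ℝ ∞ φ) (hc : HasCompactSupport φ) :
    ∃ b : ℝ × ℝ → ℝ, Integrable b ((volume.restrict (Set.Ioi 0)).prod
        (volume.restrict (Set.Ioo (-Real.pi) Real.pi))) ∧
      ∀ p ∈ polarCoord.target, ‖radialDeriv φ p‖ ≤ b p ∧ ‖angularDeriv φ p‖ ≤ b p := by
  obtain ⟨C, hC⟩ := (hφ.continuous_fderiv (by simp)).bounded_above_of_compact_support
    (hc.fderiv (𝕜 := ℝ))
  obtain ⟨R, hR⟩ := (hc.fderiv (𝕜 := ℝ)).isCompact.isBounded.subset_closedBall 0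
  have hC0 : 0 ≤ C := (norm_nonneg _).trans (hC 0)
  refine ⟨fun p => (Set.Iic R).indicator (fun _ => C) p.1 * 1, ?_, fun p hp => ?_⟩
  · refine Integrable.mul_prod (f := (Set.Iic R).indicator fun _ => C) (g := fun _ => (1 : ℝ))
      ?_ (integrable_const _)
    rw [integrable_indicator_iff measurableSet_Iic, IntegrableOn,
      Measure.restrict_restrict measurableSet_Iic, Set.inter_comm, Set.Ioi_inter_Iic]
    exact integrable_const _
  · have hp0 : 0 < p.1 := hp.1
    have hnorm : ‖fderiv ℝ φ (polarPoint p)‖ ≤ (Set.Iic R).indicator (fun _ => C) p.1 := by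
      by_cases h : p.1 ≤ R
      · rw [Set.indicator_of_mem (by exact h)]
        exact hC _
      · rw [Set.indicator_of_notMem (by exact h), norm_le_zero_iff]
        refine image_eq_zero_of_notMem_tsupport fun hm => h ?_
        have := hR hm
        rwa [mem_closedBall_zero_iff, norm_polarPoint, abs_of_pos hp0] at this
    simp only [mul_one]
    refine ⟨(ContinuousLinearMap.le_opNorm _ _).trans ?_,
      (ContinuousLinearMap.le_opNorm _ _).trans ?_⟩
    · rwa [Complex.norm_exp_ofReal_mul_I, mul_one]
    · rwa [norm_mul, Complex.norm_I, Complex.norm_exp_ofReal_mul_I, mul_one, mul_one]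

lemma restrict_polarCoord_target :
    (volume : Measure (ℝ × ℝ)).restrict polarCoord.target
      = (volume.restrict (Set.Ioi 0)).prod (volume.restrict (Set.Ioo (-Real.pi) Real.pi)) := by
  rw [polarCoord_target, Measure.volume_eq_prod, Measure.prod_restrict]

lemma integrable_mul_of_bound {k : ℝ → ℝ} (hk : Measurable k) (hk1 : ∀ r, |k r| ≤ 1)
    {f : ℝ × ℝ → ℂ} (hf : Continuous f) {b : ℝ × ℝ → ℝ}
    (hb : Integrable b ((volume.restrict (Set.Ioi 0)).prod
      (volume.restrict (Set.Ioo (-Real.pi) Real.pi))))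
    (hfb : ∀ p ∈ polarCoord.target, ‖f p‖ ≤ b p) :
    IntegrableOn (fun p : ℝ × ℝ => (k p.1 : ℂ) * f p) polarCoord.target := by
  rw [IntegrableOn]
  rw [← restrict_polarCoord_target] at hb
  refine hb.mono' ?_ ?_
  · exact ((Complex.measurable_ofReal.comp (hk.comp measurable_fst)).mul
      hf.measurable).aestronglyMeasurable
  · filter_upwards [ae_restrict_mem polarCoord.open_target.measurableSet] with p hp
    rw [norm_mul, Complex.norm_real, Real.norm_eq_abs]
    exact (mul_le_of_le_one_left (norm_nonneg _) (hk1 _)).trans (hfb p hp)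

lemma hasDerivAt_polarPoint_radius (hφ : ContDiff ℝ ∞ φ) (p : ℝ × ℝ) :
    HasDerivAt (fun r : ℝ => φ (polarPoint (r, p.2))) (radialDeriv φ p) p.1 := by
  have h1 : HasDerivAt (fun r : ℝ => polarPoint (r, p.2)) (Complex.exp (p.2 * Complex.I)) p.1 := by
    simpa [polarPoint] using
      (Complex.ofRealCLM.hasDerivAt (x := p.1)).mul_const (Complex.exp (p.2 * Complex.I))
  exact ((hφ.differentiable (by simp)) (polarPoint p)).hasFDerivAt.comp_hasDerivAt p.1 h1

lemma hasDerivAt_polarPoint_angle (hφ : ContDiff ℝ ∞ φ) (p : ℝ × ℝ) :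
    HasDerivAt (fun θ : ℝ => φ (polarPoint (p.1, θ))) (p.1 * angularDeriv φ p) p.2 := by
  have h0 : HasDerivAt (fun θ : ℝ => Complex.exp (θ * Complex.I))
      (Complex.exp (p.2 * Complex.I) * Complex.I) p.2 := by
    have := (Complex.ofRealCLM.hasDerivAt (x := p.2)).mul_const Complex.I
    simpa using this.cexp
  have h1 : HasDerivAt (fun θ : ℝ => polarPoint (p.1, θ))
      (p.1 • (Complex.I * Complex.exp (p.2 * Complex.I))) p.2 := by
    rw [Complex.real_smul, mul_comm Complex.I]
    exact h0.const_mul (p.1 : ℂ)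
  have := ((hφ.differentiable (by simp)) (polarPoint p)).hasFDerivAt.comp_hasDerivAt p.2 h1
  rw [map_smul, Complex.real_smul] at this
  exact this

/-- Up to the factor `r`, the integrand is the `θ`-derivative of a function taking equal values at
`±π`. -/
lemma integral_angularDeriv (hφ : ContDiff ℝ ∞ φ) {r : ℝ} (hr : 0 < r) :
    ∫ θ in Set.Ioo (-Real.pi) Real.pi, angularDeriv φ (r, θ) = 0 := by
  have hle : -Real.pi ≤ Real.pi := by linarith [Real.pi_pos]
  have hcont : Continuous fun θ : ℝ => (r : ℂ) * angularDeriv φ (r, θ) :=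
    continuous_const.mul ((continuous_angularDeriv hφ).comp (by fun_prop))
  have h := intervalIntegral.integral_eq_sub_of_hasDerivAt (a := -Real.pi) (b := Real.pi)
    (f := fun θ => φ (polarPoint (r, θ)))
    (f' := fun θ => (r : ℂ) * angularDeriv φ (r, θ))
    (fun θ _ => hasDerivAt_polarPoint_angle hφ (r, θ)) (hcont.intervalIntegrable _ _)
  have e : polarPoint (r, Real.pi) = polarPoint (r, -Real.pi) := by
    simp [polarPoint, Complex.exp_neg, Complex.exp_pi_mul_I]
  rw [e, sub_self, intervalIntegral.integral_const_mul] at h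
  rw [← integral_Ioc_eq_integral_Ioo, ← intervalIntegral.integral_of_le hle]
  exact (mul_eq_zero.1 h).resolve_left (by exact_mod_cast hr.ne')

end TestFunction

/-- The rotation invariant measure with radial part `ρ`. -/
noncomputable def radialMeasure (ρ : Measure ℝ) : Measure ℂ :=
  (ENNReal.ofReal (2 * Real.pi))⁻¹ •
    (ρ.prod (volume.restrict (Set.Ioo (-Real.pi) Real.pi))).map polarPoint

lemma isProbabilityMeasure_radialMeasure (ρ : Measure ℝ) [IsProbabilityMeasure ρ] :
    IsProbabilityMeasure (radialMeasure ρ) := by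
  constructor
  rw [radialMeasure, Measure.smul_apply, Measure.map_apply continuous_polarPoint.measurable
    MeasurableSet.univ, Set.preimage_univ, ← Set.univ_prod_univ, Measure.prod_prod, measure_univ,
    one_mul, Measure.restrict_apply_univ, Real.volume_Ioo,
    show Real.pi - -Real.pi = 2 * Real.pi by ring, smul_eq_mul]
  exact ENNReal.inv_mul_cancel (by simp [Real.pi_pos]) ENNReal.ofReal_ne_top

lemma integral_radialMeasure (ρ : Measure ℝ) [IsProbabilityMeasure ρ] {φ : ℂ → ℂ}
    (hφ : Continuous φ) (hc : HasCompactSupport φ) :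
    ∫ z, φ z ∂radialMeasure ρ = (2 * Real.pi : ℂ)⁻¹ *
      ∫ θ in Set.Ioo (-Real.pi) Real.pi, ∫ r, φ (polarPoint (r, θ)) ∂ρ := by
  obtain ⟨C, hC⟩ := hφ.bounded_above_of_compact_support hc
  have hInt : Integrable (fun p => φ (polarPoint p))
      (ρ.prod (volume.restrict (Set.Ioo (-Real.pi) Real.pi))) :=
    Integrable.of_bound (hφ.comp continuous_polarPoint).aestronglyMeasurable C
      (Eventually.of_forall fun p => hC _)
  rw [radialMeasure, integral_smul_measure, integral_map continuous_polarPoint.aemeasurable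
    hφ.aestronglyMeasurable, integral_prod_symm _ hInt, ENNReal.toReal_inv,
    ENNReal.toReal_ofReal (by positivity), Complex.real_smul]
  push_cast
  rfl

/-- The distributional identity `μ = π⁻¹ ∂_z (z |z|⁻² F(|z|))` for the rotation invariant measure
with radial distribution function `F`. -/
theorem integral_radialMeasure_stieltjes (F : StieltjesFunction ℝ)
    (hF0 : ∀ r < 0, F r = 0) (hF1 : Tendsto F atTop (𝓝 1)) {φ : ℂ → ℂ} (hφ : ContDiff ℝ ∞ φ)
    (hc : HasCompactSupport φ) :
    ∫ z, φ z ∂radialMeasure F.measure = (1 / (Real.pi : ℂ)) *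
      (-(1 / 2) * ∫ p in polarCoord.target, (F p.1 : ℂ) *
        (radialDeriv φ p - Complex.I * angularDeriv φ p)) := by
  have hbot : Tendsto F atBot (𝓝 0) :=
    tendsto_const_nhds.congr' ((eventually_lt_atBot 0).mono fun r hr => (hF0 r hr).symm)
  have := F.isProbabilityMeasure hbot hF1
  have hFabs : ∀ r, |F r| ≤ 1 := fun r =>
    abs_le.2 ⟨by linarith [F.mono.le_of_tendsto hbot r], F.mono.ge_of_tendsto hF1 r⟩
  obtain ⟨b, hb, hbd⟩ := exists_deriv_bound hφ hc
  have i1 := integrable_mul_of_bound F.mono.measurable hFabs (continuous_radialDeriv hφ) hb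
    (fun p hp => (hbd p hp).1)
  have i2 := integrable_mul_of_bound F.mono.measurable hFabs (continuous_angularDeriv hφ) hb
    (fun p hp => (hbd p hp).2)
  rw [IntegrableOn] at i1 i2
  have h2 : ∫ p in polarCoord.target, (F p.1 : ℂ) * angularDeriv φ p = 0 := by
    rw [restrict_polarCoord_target] at i2 ⊢
    rw [integral_prod _ i2]
    refine (setIntegral_congr_fun (g := fun _ => (0 : ℂ)) measurableSet_Ioi fun r hr => ?_).trans
      (by simp)
    simp only
    rw [integral_const_mul, integral_angularDeriv hφ hr, mul_zero]
  have h1 : ∫ p in polarCoord.target, (F p.1 : ℂ) * radialDeriv φ p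
      = -∫ θ in Set.Ioo (-Real.pi) Real.pi, ∫ r, φ (polarPoint (r, θ)) ∂F.measure := by
    rw [restrict_polarCoord_target] at i1 ⊢
    rw [integral_prod_symm _ i1, ← integral_neg]
    refine integral_congr_ae (Eventually.of_forall fun θ => ?_)
    simp only
    have hψ : ContDiff ℝ 1 fun r : ℝ => φ (polarPoint (r, θ)) := by
      refine (hφ.of_le (by simp)).comp ?_
      change ContDiff ℝ 1 fun r : ℝ => (r : ℂ) * Complex.exp (θ * Complex.I)
      exact Complex.ofRealCLM.contDiff.mul contDiff_const
    have hψc : HasCompactSupport fun r : ℝ => φ (polarPoint (r, θ)) := by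
      obtain ⟨R, hR⟩ := hc.isCompact.isBounded.subset_closedBall 0
      refine HasCompactSupport.intro (isCompact_closedBall (0 : ℝ) R) fun r hr => ?_
      refine image_eq_zero_of_notMem_tsupport fun hm => hr ?_
      have := hR hm
      rw [mem_closedBall_zero_iff, norm_polarPoint] at this
      rwa [mem_closedBall_zero_iff, Real.norm_eq_abs]
    rw [integral_stieltjes_eq_neg_integral_mul_deriv F hbot hψ hψc, neg_neg]
    have hd : ∀ r, deriv (fun r : ℝ => φ (polarPoint (r, θ))) r = radialDeriv φ (r, θ) := fun r =>
      (hasDerivAt_polarPoint_radius hφ (r, θ)).deriv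
    simp only [hd]
    rw [← integral_Ici_eq_integral_Ioi]
    refine setIntegral_eq_integral_of_forall_compl_eq_zero fun r hr => ?_
    rw [hF0 r (not_le.1 hr), Complex.ofReal_zero, zero_mul]
  have h3 : ∫ p in polarCoord.target, (F p.1 : ℂ) *
        (radialDeriv φ p - Complex.I * angularDeriv φ p)
      = -∫ θ in Set.Ioo (-Real.pi) Real.pi, ∫ r, φ (polarPoint (r, θ)) ∂F.measure := by
    have e : ∀ p : ℝ × ℝ, (F p.1 : ℂ) * (radialDeriv φ p - Complex.I * angularDeriv φ p)
        = (F p.1 : ℂ) * radialDeriv φ p - Complex.I * ((F p.1 : ℂ) * angularDeriv φ p) :=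
      fun p => by ring
    simp only [e]
    rw [integral_sub i1 (i2.const_mul _), integral_const_mul, h2, h1, mul_zero, sub_zero]
  rw [h3, integral_radialMeasure _ hφ.continuous hc, mul_inv]
  ring

/-- Convergence of the radial profiles implies convergence in the sense of distributions. -/
theorem tendsto_integral_radial {h : ℝ → ℝ → ℝ} {F : StieltjesFunction ℝ}
    (hF0 : ∀ r < 0, F r = 0) (hF1 : Tendsto F atTop (𝓝 1))
    (hm : ∀ t, 0 < t → Measurable (h t)) (hb : ∀ t, 0 < t → ∀ r, |h t r| ≤ 1)
    (hlim : ∀ᵐ r ∂(volume.restrict (Set.Ioi (0 : ℝ))),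
      Tendsto (fun t => h t r) (𝓝[>] 0) (𝓝 (F r)))
    {φ : ℂ → ℂ} (hφ : ContDiff ℝ ∞ φ) (hc : HasCompactSupport φ) :
    Tendsto (fun t : ℝ => (1 / (Real.pi : ℂ)) *
        ∫ z : ℂ, (-z / (‖z‖ : ℂ) ^ 2 * (h t ‖z‖ : ℂ)) * wirtinger φ z) (𝓝[>] 0)
      (𝓝 (∫ z, φ z ∂radialMeasure F.measure)) := by
  rw [integral_radialMeasure_stieltjes F hF0 hF1 hφ hc]
  simp only [integral_radial_mul_wirtinger]
  refine Tendsto.const_mul _ (Tendsto.const_mul _ ?_)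
  obtain ⟨b, hbi, hbd⟩ := exists_deriv_bound hφ hc
  rw [← restrict_polarCoord_target] at hbi
  have hpos : ∀ᶠ t : ℝ in 𝓝[>] 0, 0 < t := eventually_mem_nhdsWithin
  refine tendsto_integral_filter_of_dominated_convergence (fun p => b p + b p) ?_ ?_
    (hbi.add hbi) ?_
  · filter_upwards [hpos] with t ht
    exact ((Complex.measurable_ofReal.comp ((hm t ht).comp measurable_fst)).mul
      ((continuous_radialDeriv hφ).sub
        (continuous_const.mul (continuous_angularDeriv hφ))).measurable).aestronglyMeasurable
  · filter_upwards [hpos] with t ht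
    filter_upwards [ae_restrict_mem polarCoord.open_target.measurableSet] with p hp
    rw [norm_mul, Complex.norm_real, Real.norm_eq_abs]
    refine (mul_le_of_le_one_left (norm_nonneg _) (hb t ht _)).trans ((norm_sub_le _ _).trans ?_)
    rw [norm_mul, Complex.norm_I, one_mul]
    exact add_le_add (hbd p hp).1 (hbd p hp).2
  · rw [restrict_polarCoord_target]
    filter_upwards [Measure.quasiMeasurePreserving_fst.ae hlim] with p hp
    exact ((Complex.continuous_ofReal.tendsto _).comp hp).mul_const _

/-- The support of a rotation invariant measure whose radial part has support `[0, R]`. -/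
theorem support_radialMeasure {F : StieltjesFunction ℝ} {R : ℝ} (hR : 0 < R)
    (hF0 : ∀ r < 0, F r = 0) (hF1 : ∀ r, R ≤ r → F r = 1)
    (hs : StrictMonoOn F (Set.Ioo 0 R)) :
    (radialMeasure F.measure).support = Metric.closedBall 0 R := by
  have hbot : Tendsto F atBot (𝓝 0) :=
    tendsto_const_nhds.congr' ((eventually_lt_atBot 0).mono fun r hr => (hF0 r hr).symm)
  have htop : Tendsto F atTop (𝓝 1) :=
    tendsto_const_nhds.congr' ((eventually_ge_atTop R).mono fun r hr => (hF1 r hr).symm)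
  have := F.isProbabilityMeasure hbot htop
  have hc : (ENNReal.ofReal (2 * Real.pi))⁻¹ ≠ 0 := ENNReal.inv_ne_zero.2 ENNReal.ofReal_ne_top
  apply Set.Subset.antisymm
  · refine Measure.support_subset_of_isClosed Metric.isClosed_closedBall ?_
    rw [mem_ae_iff, radialMeasure, Measure.smul_apply,
      Measure.map_apply continuous_polarPoint.measurable
        Metric.isClosed_closedBall.measurableSet.compl]
    have hsub : polarPoint ⁻¹' (Metric.closedBall 0 R)ᶜ ⊆ (Set.Iic (-R) ∪ Set.Ioi R) ×ˢ Set.univ := by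
      intro p hp
      rw [Set.mem_preimage, Set.mem_compl_iff, mem_closedBall_zero_iff, norm_polarPoint,
        not_le, lt_abs] at hp
      refine ⟨?_, trivial⟩
      rcases hp with hp | hp
      · exact Or.inr hp
      · exact Or.inl (by simp only [Set.mem_Iic]; linarith)
    have hz : F.measure (Set.Iic (-R) ∪ Set.Ioi R) = 0 := by
      refine measure_union_null ?_ ?_
      · rw [F.measure_Iic hbot, hF0 _ (by linarith)]; simp
      · rw [F.measure_Ioi htop, hF1 R le_rfl]; simp
    rw [measure_mono_null hsub (by rw [Measure.prod_prod, hz, zero_mul]), smul_zero]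
  · have hball : Metric.ball (0 : ℂ) R ⊆ (radialMeasure F.measure).support := by
      intro z hz
      rw [mem_ball_zero_iff] at hz
      rw [Measure.support_eq_forall_isOpen]
      intro U hzU hU
      rw [radialMeasure, Measure.smul_apply, Measure.map_apply continuous_polarPoint.measurable
        hU.measurableSet, smul_eq_mul]
      refine ENNReal.mul_pos hc (ne_of_gt ?_)
      have hz' : polarPoint (‖z‖, z.arg) = z := by
        simp only [polarPoint]
        exact Complex.norm_mul_exp_arg_mul_I z
      have hO : IsOpen (polarPoint ⁻¹' U) := hU.preimage continuous_polarPoint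
      obtain ⟨A, B, hA, hB, hxA, hyB, hAB⟩ := isOpen_prod_iff.1 hO ‖z‖ z.arg
        (show polarPoint (‖z‖, z.arg) ∈ U by rwa [hz'])
      -- The radius is moved outwards, which also works at `z = 0`, and the angle is moved down,
      -- because `arg z` may equal the excluded endpoint `π`.
      obtain ⟨u, hu, huA⟩ : ∃ u > ‖z‖, Set.Ico ‖z‖ u ⊆ A :=
        (mem_nhdsGE_iff_exists_Ico_subset).1 (mem_nhdsWithin_of_mem_nhds (hA.mem_nhds hxA))
      obtain ⟨l, hl, hlB⟩ : ∃ l < z.arg, Set.Ioc l z.arg ⊆ B :=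
        (mem_nhdsLE_iff_exists_Ioc_subset).1 (mem_nhdsWithin_of_mem_nhds (hB.mem_nhds hyB))
      have hlt : ‖z‖ < min u R := lt_min hu hz
      obtain ⟨x, hx1, hx2⟩ := exists_between hlt
      obtain ⟨y, hy1, hy2⟩ := exists_between hx2
      have hx0 : 0 < x := (norm_nonneg z).trans_lt hx1
      have hFxy : 0 < F.measure (Set.Ioc x y) := by
        rw [F.measure_Ioc]
        exact ENNReal.ofReal_pos.2 (sub_pos.2 (hs ⟨hx0, hx2.trans_le (min_le_right _ _)⟩
          ⟨hx0.trans hy1, hy2.trans_le (min_le_right _ _)⟩ hy1))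
      have hvol : 0 < (volume.restrict (Set.Ioo (-Real.pi) Real.pi)) (Set.Ioo l z.arg) := by
        rw [Measure.restrict_apply measurableSet_Ioo, Set.Ioo_inter_Ioo, Real.volume_Ioo]
        refine ENNReal.ofReal_pos.2 (sub_pos.2 (max_lt (lt_min hl ?_) (lt_min ?_ ?_)))
        · exact hl.trans_le (Complex.arg_le_pi z)
        · exact Complex.neg_pi_lt_arg z
        · linarith [Real.pi_pos]
      refine (ENNReal.mul_pos hFxy.ne' hvol.ne').trans_le ?_
      rw [← Measure.prod_prod]
      refine measure_mono fun p hp => hAB ⟨huA ⟨?_, ?_⟩, hlB ⟨hp.2.1, hp.2.2.le⟩⟩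
      · exact hx1.le.trans hp.1.1.le
      · exact hp.1.2.trans_lt (hy2.trans_le (min_le_left _ _))
    rw [← closure_ball (0 : ℂ) hR.ne']
    exact closure_minimal hball Measure.isClosed_support

/-! ### Test functions determine finite measures -/

/-- An open set `U` is the support of a smooth `f` with values in `[0, 1]`, and `1 - (1 - f)^n`
tends to the indicator of `U`. Bumps on growing balls make the approximants compactly supported;
dominated convergence and the π-system of open sets finish. -/
theorem ext_of_forall_integral_contDiff {μ ν : Measure ℂ} [IsFiniteMeasure μ] [IsFiniteMeasure ν]
    (h : ∀ φ : ℂ → ℂ, ContDiff ℝ ∞ φ → HasCompactSupport φ → ∫ z, φ z ∂μ = ∫ z, φ z ∂ν) :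
    μ = ν := by
  have hopen : ∀ U : Set ℂ, IsOpen U → μ U = ν U := by
    intro U hU
    obtain ⟨f, hfs, hf, hfr⟩ := hU.exists_contDiff_support_eq (n := ⊤)
    have hf01 : ∀ z, 0 ≤ f z ∧ f z ≤ 1 := fun z => hfr ⟨z, rfl⟩
    let χ : ℕ → ContDiffBump (0 : ℂ) := fun n => ⟨n + 1, n + 2, by positivity, by linarith⟩
    let φ : ℕ → ℂ → ℂ := fun n z => (((1 - (1 - f z) ^ n) * χ n z : ℝ) : ℂ)
    have hφ : ∀ n, ContDiff ℝ ∞ (φ n) := fun n =>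
      Complex.ofRealCLM.contDiff.comp ((contDiff_const.sub ((contDiff_const.sub hf).pow n)).mul
        (χ n).contDiff)
    have hφc : ∀ n, HasCompactSupport (φ n) := fun n =>
      ((χ n).hasCompactSupport.mul_left (f := fun z => 1 - (1 - f z) ^ n)).comp_left
        (g := fun x : ℝ => (x : ℂ)) Complex.ofReal_zero
    have hbound : ∀ n z, ‖φ n z‖ ≤ 1 := fun n z => by
      have h0 : 0 ≤ 1 - f z := sub_nonneg.2 (hf01 z).2
      have h1 : (1 - f z) ^ n ≤ 1 := pow_le_one₀ h0 (by linarith [(hf01 z).1])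
      have h2 : 0 ≤ (1 - f z) ^ n := pow_nonneg h0 n
      rw [Complex.norm_real, Real.norm_eq_abs, abs_mul, abs_of_nonneg (by linarith),
        abs_of_nonneg (χ n).nonneg]
      exact mul_le_one₀ (by linarith) (χ n).nonneg (χ n).le_one
    have hlim : ∀ z, Tendsto (fun n => φ n z) atTop (𝓝 (U.indicator (fun _ => (1 : ℂ)) z)) := by
      intro z
      by_cases hz : z ∈ U
      · have hfz : 0 < f z := lt_of_le_of_ne (hf01 z).1 (Ne.symm (by
          rw [← hfs] at hz; exact hz))
        rw [Set.indicator_of_mem hz, ← Complex.ofReal_one]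
        refine (Complex.continuous_ofReal.tendsto _).comp ?_
        have h1 : Tendsto (fun n : ℕ => 1 - (1 - f z) ^ n) atTop (𝓝 (1 - 0)) :=
          tendsto_const_nhds.sub (tendsto_pow_atTop_nhds_zero_of_lt_one
            (sub_nonneg.2 (hf01 z).2) (by linarith))
        rw [sub_zero] at h1
        refine h1.congr' ?_
        filter_upwards [eventually_ge_atTop ⌈‖z‖⌉₊] with n hn
        have : χ n z = 1 := by
          refine (χ n).one_of_mem_closedBall ?_
          rw [mem_closedBall_zero_iff]
          have := (Nat.le_ceil ‖z‖).trans (Nat.cast_le.2 hn)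
          change ‖z‖ ≤ (n : ℝ) + 1
          linarith
        rw [this, mul_one]
      · have hfz : f z = 0 := by
          rw [← hfs] at hz
          exact Function.notMem_support.1 hz
        rw [Set.indicator_of_notMem hz]
        refine tendsto_const_nhds.congr fun n => ?_
        simp [φ, hfz]
    have main : ∀ ρ : Measure ℂ, IsFiniteMeasure ρ →
        Tendsto (fun n => ∫ z, φ n z ∂ρ) atTop (𝓝 (ρ.real U : ℂ)) := by
      intro ρ hρ
      have := tendsto_integral_of_dominated_convergence (μ := ρ) (F := φ) (fun _ => (1 : ℝ))
        (fun n => (hφ n).continuous.aestronglyMeasurable) (integrable_const _)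
        (fun n => Eventually.of_forall (hbound n)) (Eventually.of_forall hlim)
      rwa [integral_indicator hU.measurableSet, setIntegral_const, Complex.real_smul,
        mul_one] at this
    have e := tendsto_nhds_unique (main μ inferInstance)
      ((main ν inferInstance).congr fun n => (h _ (hφ n) (hφc n)).symm)
    exact (measureReal_eq_measureReal_iff).1 (Complex.ofReal_injective e)
  exact ext_of_generate_finite _ (BorelSpace.measurable_eq (α := ℂ)) isPiSystem_isOpen
    (fun U hU => hopen U hU) (hopen _ isOpen_univ)

/-! ### Rotations -/

lemma wirtinger_comp_mul (φ : ℂ → ℂ) (hφ : Differentiable ℝ φ) (w z : ℂ) :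
    wirtinger (fun u => φ (w * u)) z = w * wirtinger φ (w * z) := by
  have hd : HasFDerivAt (fun u => φ (w * u))
      ((fderiv ℝ φ (w * z)).comp ((ContinuousLinearMap.mul ℝ ℂ) w)) z :=
    (hφ (w * z)).hasFDerivAt.comp z ((ContinuousLinearMap.mul ℝ ℂ) w).hasFDerivAt
  rw [wirtinger, wirtinger, hd.fderiv]
  simp only [ContinuousLinearMap.comp_apply, ContinuousLinearMap.mul_apply']
  set L := fderiv ℝ φ (w * z)
  have e1 : w * 1 = w.re • (1 : ℂ) + w.im • Complex.I := by simp
  have e2 : w * Complex.I = w.re • Complex.I - w.im • (1 : ℂ) := by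
    conv_lhs => rw [← Complex.re_add_im w]
    simp only [Complex.real_smul]
    linear_combination (w.im : ℂ) * Complex.I_mul_I
  rw [e1, e2, map_add, map_sub, map_smul, map_smul, map_smul, map_smul]
  simp only [Complex.real_smul]
  conv_rhs => rw [← Complex.re_add_im w]
  linear_combination ((1 / 2) * (w.im : ℂ) * L Complex.I) * Complex.I_mul_I

/-- The factor `w` from the chain rule rotates `-z` to `-(w z)`, and rotations preserve Lebesgue
measure. -/
lemma integral_radial_comp_rotation (k : ℝ → ℝ) {φ : ℂ → ℂ} (hφ : Differentiable ℝ φ) {w : ℂ}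
    (hw : ‖w‖ = 1) :
    ∫ z : ℂ, (-z / (‖z‖ : ℂ) ^ 2 * (k ‖z‖ : ℂ)) * wirtinger (fun u => φ (w * u)) z
      = ∫ z : ℂ, (-z / (‖z‖ : ℂ) ^ 2 * (k ‖z‖ : ℂ)) * wirtinger φ z := by
  let c : Circle := ⟨w, mem_sphere_zero_iff_norm.2 hw⟩
  have hrot : MeasurePreserving (rotation c) := (rotation c).measurePreserving
  refine Eq.trans ?_ (hrot.integral_comp (rotation c).toHomeomorph.measurableEmbedding _)
  refine integral_congr_ae (Eventually.of_forall fun z => ?_)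
  have e : rotation c z = w * z := rotation_apply c z
  simp only [e, norm_mul, hw, one_mul, wirtinger_comp_mul φ hφ]
  ring

/-! ### The limiting measure -/

lemma IsSolution.eq_ofReal_mul_I (hα : ∀ c, 0 < α c) {z : ℂ} {t : ℝ} (ht : 0 < t)
    {a a' : Fin D → ℂ} {v w : Fin D → ℝ} (h : IsSolution α g z (t * Complex.I) a a')
    (hr : IsRealSolution α g (‖z‖ ^ 2) t v w) :
    a = (fun d => v d * Complex.I) ∧ a' = fun d => w d * Complex.I :=
  h.unique hα ht hr.isSolution

/-- This puts the field in the radial form to which the polar coordinate computation applies, with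
`meanWeight` as the candidate radial distribution function. -/
lemma IsSolution.bTrace_eq (hα : ∀ c, 0 < α c) {z : ℂ} {t : ℝ} (ht : 0 < t)
    {a a' : Fin D → ℂ} {v w : Fin D → ℝ} (h : IsSolution α g z (t * Complex.I) a a')
    (hr : IsRealSolution α g (‖z‖ ^ 2) t v w) :
    bTrace α g z (t * Complex.I) a a'
      = -z / (‖z‖ : ℂ) ^ 2 * (meanWeight α g (‖z‖ ^ 2) t v w : ℂ) := by
  obtain ⟨rfl, rfl⟩ := h.eq_ofReal_mul_I hα ht hr
  rw [bTrace, meanWeight, Complex.ofReal_sum, Finset.mul_sum]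
  refine Finset.sum_congr rfl fun c _ => ?_
  rw [denom_ofReal_mul_I, weight]
  rcases eq_or_ne z 0 with rfl | hz
  · simp
  · have hz' : (‖z‖ : ℂ) ≠ 0 := by exact_mod_cast norm_ne_zero_iff.2 hz
    push_cast
    rw [div_mul_eq_mul_div, eq_div_iff (pow_ne_zero 2 hz')]
    ring

/-- A choice of real solutions for all parameters. -/
structure IsRealFamily (α : Fin D → ℝ) (g : Matrix (Fin D) (Fin D) ℝ)
    (V W : ℝ → ℝ → Fin D → ℝ) : Prop where
  sol : ∀ τ t, 0 ≤ τ → 0 < t → IsRealSolution α g τ t (V τ t) (W τ t)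

lemma exists_isRealFamily (hα : ∀ c, 0 < α c) : ∃ V W, IsRealFamily α g V W := by
  have : ∀ τ t : ℝ, ∃ v w, 0 ≤ τ → 0 < t → IsRealSolution α g τ t v w := fun τ t => by
    by_cases h : 0 ≤ τ ∧ 0 < t
    · obtain ⟨v, w, hvw⟩ := exists_isRealSolution (g := g) hα h.1 h.2
      exact ⟨v, w, fun _ _ => hvw⟩
    · exact ⟨0, 0, fun h1 h2 => absurd ⟨h1, h2⟩ h⟩
  choose V W h using this
  exact ⟨V, W, ⟨h⟩⟩

/-- The mean weight at `|z| = r`, extended by zero to nonpositive `r`. -/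
noncomputable def profile (α : Fin D → ℝ) (g : Matrix (Fin D) (Fin D) ℝ)
    (V W : ℝ → ℝ → Fin D → ℝ) (t r : ℝ) : ℝ :=
  if r ≤ 0 then 0 else meanWeight α g (r ^ 2) t (V (r ^ 2) t) (W (r ^ 2) t)

lemma profile_of_pos {V W : ℝ → ℝ → Fin D → ℝ} {t r : ℝ} (hr : 0 < r) :
    profile α g V W t r = meanWeight α g (r ^ 2) t (V (r ^ 2) t) (W (r ^ 2) t) :=
  if_neg (not_le.2 hr)

namespace IsRealFamily

variable {V W : ℝ → ℝ → Fin D → ℝ}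

lemma profile_nonneg (h : IsRealFamily α g V W) (hα : ∀ c, 0 < α c) (hg : ∀ c d, 0 < g c d)
    {t : ℝ} (ht : 0 < t) (r : ℝ) : 0 ≤ profile α g V W t r := by
  rw [profile]
  split_ifs
  · exact le_rfl
  · exact (h.sol _ t (sq_nonneg r) ht).meanWeight_nonneg hα hg (sq_nonneg r) ht.le

lemma profile_le_one (h : IsRealFamily α g V W) (hα : ∀ c, 0 < α c) (hsum : ∑ c, α c = 1)
    (hg : ∀ c d, 0 < g c d) {t : ℝ} (ht : 0 < t) (r : ℝ) : profile α g V W t r ≤ 1 := by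
  rw [profile]
  split_ifs
  · exact zero_le_one
  · exact (h.sol _ t (sq_nonneg r) ht).meanWeight_le_one hα hsum hg (sq_nonneg r) ht.le

lemma monotone_profile (h : IsRealFamily α g V W) (hα : ∀ c, 0 < α c) (hg : ∀ c d, 0 < g c d)
    {t : ℝ} (ht : 0 < t) : Monotone (profile α g V W t) := by
  intro r s hrs
  rcases le_or_gt r 0 with hr | hr
  · rw [profile, if_pos hr]
    exact h.profile_nonneg hα hg ht s
  · rw [profile_of_pos hr, profile_of_pos (hr.trans_le hrs)]
    exact meanWeight_mono hα hg (pow_pos hr 2) (by gcongr) ht.le (h.sol _ t (sq_nonneg r) ht)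
      (h.sol _ t (sq_nonneg s) ht)

lemma bTrace_eq_profile (h : IsRealFamily α g V W) (hα : ∀ c, 0 < α c) {z : ℂ} {t : ℝ}
    (ht : 0 < t) {a a' : Fin D → ℂ} (hs : IsSolution α g z (t * Complex.I) a a') :
    bTrace α g z (t * Complex.I) a a' = -z / (‖z‖ : ℂ) ^ 2 * (profile α g V W t ‖z‖ : ℂ) := by
  rw [hs.bTrace_eq hα ht (h.sol _ t (sq_nonneg _) ht)]
  rcases eq_or_ne z 0 with rfl | hz
  · simp
  · rw [profile_of_pos (norm_pos_iff.2 hz)]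

/-- The limiting measure is characterized by the radial profiles. -/
lemma isLimitingMeasure_iff (h : IsRealFamily α g V W) (hα : ∀ c, 0 < α c) (μ : Measure ℂ) :
    IsLimitingMeasure α g μ ↔ IsProbabilityMeasure μ ∧
      ∀ φ : ℂ → ℂ, ContDiff ℝ ∞ φ → HasCompactSupport φ →
        Tendsto (fun t : ℝ => (1 / (Real.pi : ℂ)) *
          ∫ z : ℂ, (-z / (‖z‖ : ℂ) ^ 2 * (profile α g V W t ‖z‖ : ℂ)) * wirtinger φ z)
          (𝓝[>] 0) (𝓝 (∫ z, φ z ∂μ)) := by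
  -- By uniqueness of the solution, every choice of `a`, `a'` gives the same integrals for `t > 0`,
  -- so the existential choice in the definition is harmless.
  have congr : ∀ (a a' : ℂ → ℝ → Fin D → ℂ),
      (∀ z : ℂ, ∀ t : ℝ, 0 < t → IsSolution α g z (t * Complex.I) (a z t) (a' z t)) →
      ∀ φ : ℂ → ℂ, (fun t : ℝ => (1 / (Real.pi : ℂ)) *
          ∫ z : ℂ, bTrace α g z (t * Complex.I) (a z t) (a' z t) * wirtinger φ z)
        =ᶠ[𝓝[>] 0] fun t : ℝ => (1 / (Real.pi : ℂ)) *
          ∫ z : ℂ, (-z / (‖z‖ : ℂ) ^ 2 * (profile α g V W t ‖z‖ : ℂ)) * wirtinger φ z := by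
    intro a a' ha φ
    filter_upwards [eventually_mem_nhdsWithin] with t ht
    congr 1
    refine integral_congr_ae (Eventually.of_forall fun z => ?_)
    simp only
    rw [h.bTrace_eq_profile hα ht (ha z t ht)]
  refine and_congr_right fun _ => ⟨?_, fun H => ?_⟩
  · rintro ⟨a, a', ha, H⟩ φ hφ hc
    exact (H φ hφ hc).congr' (congr a a' ha φ)
  · have ha : ∀ z : ℂ, ∀ t : ℝ, 0 < t → IsSolution α g z (t * Complex.I)
        (fun d => V (‖z‖ ^ 2) t d * Complex.I) (fun d => W (‖z‖ ^ 2) t d * Complex.I) :=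
      fun z t ht => (h.sol _ t (sq_nonneg _) ht).isSolution
    exact ⟨_, _, ha, fun φ hφ hc => (H φ hφ hc).congr'
      (congr (fun z t d => V (‖z‖ ^ 2) t d * Complex.I)
        (fun z t d => W (‖z‖ ^ 2) t d * Complex.I) ha φ).symm⟩

/-- The limit of the profiles is a radial distribution function. -/
lemma exists_stieltjesFunction [Nonempty (Fin D)] (h : IsRealFamily α g V W)
    (hα : ∀ c, 0 < α c) (hsum : ∑ c, α c = 1) (hg : ∀ c d, 0 < g c d) :
    ∃ F : StieltjesFunction ℝ, (∀ r < 0, F r = 0) ∧ (∀ r, √(perronEigenvalue α g) ≤ r → F r = 1) ∧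
      StrictMonoOn F (Set.Ioo 0 √(perronEigenvalue α g)) ∧
      ∀ᵐ r ∂(volume.restrict (Set.Ioi (0 : ℝ))),
        Tendsto (fun t => profile α g V W t r) (𝓝[>] 0) (𝓝 (F r)) := by
  have hl := (perronEigenvalue_spec hα hg).1
  set R := √(perronEigenvalue α g) with hRdef
  have hR : 0 < R := Real.sqrt_pos.2 hl
  have hR2 : R ^ 2 = perronEigenvalue α g := Real.sq_sqrt hl.le
  have hpos : ∀ᶠ t : ℝ in 𝓝[>] 0, 0 < t := eventually_mem_nhdsWithin
  have ex : ∀ r : ℝ, ∃ x : ℝ, 0 < r → r < R →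
      (∃ v w, IsRealSolution α g (r ^ 2) 0 v w ∧ x = meanWeight α g (r ^ 2) 0 v w) ∧
      Tendsto (fun t => profile α g V W t r) (𝓝[>] 0) (𝓝 x) := by
    intro r
    by_cases hr : 0 < r ∧ r < R
    · obtain ⟨v, w, hvw, hlim⟩ := exists_tendsto_meanWeight hα hsum hg (pow_pos hr.1 2)
        (by rw [← hR2]; exact pow_lt_pow_left₀ hr.2 hr.1.le two_ne_zero)
        (fun t ht => h.sol (r ^ 2) t (sq_nonneg r) ht)
      refine ⟨_, fun _ _ => ⟨⟨v, w, hvw, rfl⟩, ?_⟩⟩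
      simpa only [profile_of_pos hr.1] using hlim
    · exact ⟨0, fun h1 h2 => absurd ⟨h1, h2⟩ hr⟩
  choose X hX using ex
  -- The value `1` at `R` itself is a convention: convergence is claimed only for `r ≠ R`, a null
  -- exception.
  let H : ℝ → ℝ := fun r => if r ≤ 0 then 0 else if r < R then X r else 1
  have H0 : ∀ r, r ≤ 0 → H r = 0 := fun r hr => if_pos hr
  have H1 : ∀ r, R ≤ r → H r = 1 := fun r hr => by
    simp only [H, if_neg (not_le.2 (hR.trans_le hr)), if_neg (not_lt.2 hr)]
  have HX : ∀ r, 0 < r → r < R → H r = X r := fun r h1 h2 => by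
    simp only [H, if_neg (not_le.2 h1), if_pos h2]
  have Hlim : ∀ r, 0 < r → r ≠ R →
      Tendsto (fun t => profile α g V W t r) (𝓝[>] 0) (𝓝 (H r)) := by
    intro r hr hne
    rcases lt_or_gt_of_ne hne with hlt | hgt
    · rw [HX r hr hlt]
      exact (hX r hr hlt).2
    · rw [H1 r hgt.le]
      have := tendsto_meanWeight_one (τ := r ^ 2) hα hsum hg
        (by rw [← hR2]; exact pow_lt_pow_left₀ hgt hR.le two_ne_zero)
        (fun t ht => h.sol (r ^ 2) t (sq_nonneg r) ht)
      simpa only [profile_of_pos hr] using this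
  have X01 : ∀ r, 0 < r → r < R → 0 ≤ X r ∧ X r ≤ 1 := fun r h1 h2 =>
    ⟨ge_of_tendsto (hX r h1 h2).2 (hpos.mono fun t ht => h.profile_nonneg hα hg ht r),
      le_of_tendsto (hX r h1 h2).2 (hpos.mono fun t ht => h.profile_le_one hα hsum hg ht r)⟩
  have Hnonneg : ∀ r, 0 ≤ H r := fun r => by
    simp only [H]
    split_ifs with h1 h2
    · exact le_rfl
    · exact (X01 r (not_le.1 h1) h2).1
    · exact zero_le_one
  have Hle : ∀ r, H r ≤ 1 := fun r => by
    simp only [H]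
    split_ifs with h1 h2
    · exact zero_le_one
    · exact (X01 r (not_le.1 h1) h2).2
    · exact le_rfl
  have Hmono : Monotone H := by
    intro r s hrs
    rcases le_or_gt r 0 with hr | hr
    · rw [H0 r hr]; exact Hnonneg s
    rcases lt_or_ge s R with hs | hs
    · exact le_of_tendsto_of_tendsto (Hlim r hr (hrs.trans_lt hs).ne)
        (Hlim s (hr.trans_le hrs) hs.ne) (hpos.mono fun t ht => h.monotone_profile hα hg ht hrs)
    · rw [H1 s hs]; exact Hle r
  have Hstrict : StrictMonoOn H (Set.Ioo 0 R) := by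
    intro r hr s hs hrs
    refine (Hmono hrs.le).lt_of_ne fun he => ?_
    rw [HX r hr.1 hr.2, HX s hs.1 hs.2] at he
    obtain ⟨⟨v₁, w₁, h₁, e₁⟩, -⟩ := hX r hr.1 hr.2
    obtain ⟨⟨v₂, w₂, h₂, e₂⟩, -⟩ := hX s hs.1 hs.2
    have := meanWeight_injective hα hg (pow_pos hr.1 2) (pow_pos hs.1 2) le_rfl h₁ h₂
      (by rw [← e₁, ← e₂, he])
    exact absurd this (pow_lt_pow_left₀ hrs hr.1.le two_ne_zero).ne
  refine ⟨Hmono.stieltjesFunction, fun r hr => ?_, fun r hr => ?_, fun r hr s hs hrs => ?_, ?_⟩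
  · refine le_antisymm ?_ ((Hnonneg r).trans (Hmono.le_rightLim le_rfl))
    exact (Hmono.rightLim_le (show r < r / 2 by linarith)).trans (H0 _ (by linarith)).le
  · refine le_antisymm ((Hmono.rightLim_le (lt_add_one r)).trans (Hle _)) ?_
    exact (H1 r hr).symm.le.trans (Hmono.le_rightLim le_rfl)
  -- The right limit at `r` is controlled only by values strictly to the right of `r`, hence the
  -- intermediate point.
  · obtain ⟨m, hm1, hm2⟩ := exists_between hrs
    exact (Hmono.rightLim_le hm1).trans_lt ((Hstrict ⟨hr.1.trans hm1, hm2.trans hs.2⟩ hs hm2).trans_le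
      (Hmono.le_rightLim le_rfl))
  -- A monotone function has countably many discontinuities; elsewhere the right-continuous version
  -- equals `H`, and almost everywhere convergence is all that dominated convergence needs.
  · have hcont : ∀ᵐ r : ℝ, ContinuousAt H r := by
      have := Hmono.countable_not_continuousAt.measure_zero volume
      rwa [ae_iff]
    have hne : ∀ᵐ r : ℝ, r ≠ R := by
      rw [ae_iff]
      simp
    filter_upwards [ae_restrict_of_ae hcont, ae_restrict_of_ae hne,
      ae_restrict_mem measurableSet_Ioi] with r hr1 hr2 hr3
    rw [Hmono.stieltjesFunction_eq, hr1.continuousWithinAt.rightLim_eq]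
    exact Hlim r hr3 hr2

end IsRealFamily

theorem existsUnique_isLimitingMeasure [Nonempty (Fin D)] (hα : ∀ c, 0 < α c)
    (hsum : ∑ c, α c = 1) (hg : ∀ c d, 0 < g c d) :
    ∃ μ : Measure ℂ, IsLimitingMeasure α g μ ∧ (∀ ν, IsLimitingMeasure α g ν → ν = μ) ∧
      μ.support = Metric.closedBall (0 : ℂ) √(perronEigenvalue α g) ∧
      ∀ w : ℂ, ‖w‖ = 1 → μ.map (fun z => w * z) = μ := by
  obtain ⟨V, W, h⟩ := exists_isRealFamily (g := g) hα
  obtain ⟨F, hF0, hF1, hs, hlim⟩ := h.exists_stieltjesFunction hα hsum hg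
  have hR : 0 < √(perronEigenvalue α g) := Real.sqrt_pos.2 (perronEigenvalue_spec hα hg).1
  have hbot : Tendsto F atBot (𝓝 0) :=
    tendsto_const_nhds.congr' ((eventually_lt_atBot 0).mono fun r hr => (hF0 r hr).symm)
  have htop : Tendsto F atTop (𝓝 1) :=
    tendsto_const_nhds.congr' ((eventually_ge_atTop _).mono fun r hr => (hF1 r hr).symm)
  have := F.isProbabilityMeasure hbot htop
  have hprob := isProbabilityMeasure_radialMeasure F.measure
  have hmain : IsLimitingMeasure α g (radialMeasure F.measure) := by
    refine (h.isLimitingMeasure_iff hα _).2 ⟨hprob, fun φ hφ hc => ?_⟩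
    exact tendsto_integral_radial hF0 htop
      (fun t ht => (h.monotone_profile hα hg ht).measurable)
      (fun t ht r => abs_le.2 ⟨by linarith [h.profile_nonneg hα hg ht r],
        h.profile_le_one hα hsum hg ht r⟩) hlim hφ hc
  have huniq : ∀ ν, IsLimitingMeasure α g ν → ν = radialMeasure F.measure := by
    intro ν hν
    have hν' := (h.isLimitingMeasure_iff hα ν).1 hν
    have hμ' := (h.isLimitingMeasure_iff hα _).1 hmain
    have := hν'.1
    exact ext_of_forall_integral_contDiff fun φ hφ hc =>
      tendsto_nhds_unique (hν'.2 φ hφ hc) (hμ'.2 φ hφ hc)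
  -- Rotation invariance follows from uniqueness: the rotated measure satisfies the same limit
  -- relation.
  refine ⟨_, hmain, huniq, support_radialMeasure hR hF0 hF1 hs, fun w hw => huniq _ ?_⟩
  have hmeas : Measurable fun z : ℂ => w * z := measurable_const_mul w
  refine (h.isLimitingMeasure_iff hα _).2
    ⟨Measure.isProbabilityMeasure_map hmeas.aemeasurable, fun φ hφ hc => ?_⟩
  have hw0 : w ≠ 0 := norm_ne_zero_iff.1 (by rw [hw]; exact one_ne_zero)
  have hφw : ContDiff ℝ ∞ fun u => φ (w * u) := hφ.comp (contDiff_const.mul contDiff_id)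
  have hcw : HasCompactSupport fun u => φ (w * u) :=
    hc.comp_homeomorph (Homeomorph.mulLeft₀ w hw0)
  rw [integral_map hmeas.aemeasurable hφ.continuous.aestronglyMeasurable]
  have := ((h.isLimitingMeasure_iff hα _).1 hmain).2 _ hφw hcw
  simpa only [integral_radial_comp_rotation _ (hφ.differentiable (by simp)) hw] using this

/-! ### The solution inside and outside the disk -/

theorem solution_limit [Nonempty (Fin D)] (hα : ∀ c, 0 < α c) (hg : ∀ c d, 0 < g c d) (z : ℂ)
    (a a' : ℝ → Fin D → ℂ)
    (h : ∀ t : ℝ, 0 < t → IsSolution α g z (t * Complex.I) (a t) (a' t)) :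
    (‖z‖ ^ 2 < perronEigenvalue α g →
      ∃ C : ℝ, 0 < C ∧ ∀ᶠ t in 𝓝[>] (0 : ℝ), C ≤ ‖∑ c, (α c : ℂ) * a t c‖) ∧
    (perronEigenvalue α g < ‖z‖ ^ 2 →
      Tendsto a (𝓝[>] 0) (𝓝 0) ∧ Tendsto a' (𝓝[>] 0) (𝓝 0)) := by
  obtain ⟨V, W, hf⟩ := exists_isRealFamily (g := g) hα
  have hsol : ∀ t, 0 < t → IsRealSolution α g (‖z‖ ^ 2) t (V (‖z‖ ^ 2) t) (W (‖z‖ ^ 2) t) :=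
    fun t ht => hf.sol _ t (sq_nonneg _) ht
  have hpos : ∀ᶠ t : ℝ in 𝓝[>] 0, 0 < t := eventually_mem_nhdsWithin
  refine ⟨fun hz => ?_, fun hz => ?_⟩
  · obtain ⟨C, hC, hev⟩ := eventually_sum_ge hα hg (sq_nonneg _) hz hsol
    refine ⟨C, hC, ?_⟩
    filter_upwards [hev, hpos] with t htC ht
    refine htC.trans (le_of_eq ?_)
    rw [((h t ht).eq_ofReal_mul_I hα ht (hsol t ht)).1]
    simp only [← mul_assoc, ← Finset.sum_mul, ← Complex.ofReal_mul, ← Complex.ofReal_sum]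
    rw [norm_mul, Complex.norm_I, mul_one, Complex.norm_real, Real.norm_of_nonneg
      ((hsol t ht).sum_pos hα).le]
  · obtain ⟨hV, hW⟩ := tendsto_zero_of_perronEigenvalue_lt hα hg hz hsol
    have lift : ∀ X : ℝ → Fin D → ℝ, Tendsto X (𝓝[>] 0) (𝓝 0) →
        Tendsto (fun t d => (X t d : ℂ) * Complex.I) (𝓝[>] 0) (𝓝 0) := by
      intro X hX
      refine tendsto_pi_nhds.2 fun d => ?_
      have := ((Complex.continuous_ofReal.tendsto _).comp
        (tendsto_pi_nhds.1 hX d)).mul_const Complex.I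
      simpa using this
    refine ⟨(lift _ hV).congr' ?_, (lift _ hW).congr' ?_⟩
    · filter_upwards [hpos] with t ht using
        ((h t ht).eq_ofReal_mul_I hα ht (hsol t ht)).1.symm
    · filter_upwards [hpos] with t ht using
        ((h t ht).eq_ofReal_mul_I hα ht (hsol t ht)).2.symm

end BlockMatrix

theorem mainTheorem2 {D : ℕ} (α : Fin D → ℝ) (g : Matrix (Fin D) (Fin D) ℝ)
    (hα : ∀ c, 0 < α c) (hsum : ∑ c, α c = 1) (hg : ∀ c d, 0 < g c d) :
    -- the fixed-point equations have a unique positive solution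
    (∀ z : ℂ, ∀ t : ℝ, 0 < t →
      ∃! p : (Fin D → ℂ) × (Fin D → ℂ),
        BlockMatrix.IsSolution α g z (t * Complex.I) p.1 p.2) ∧
    -- the limiting measure exists and is unique
    (∃! μ : MeasureTheory.Measure ℂ, BlockMatrix.IsLimitingMeasure α g μ) ∧
    -- its support is the closed disk of radius `√λ`, and it is radially symmetric
    (∀ μ : MeasureTheory.Measure ℂ, BlockMatrix.IsLimitingMeasure α g μ →
      μ.support = Metric.closedBall (0 : ℂ) (Real.sqrt (BlockMatrix.perronEigenvalue α g)) ∧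
      ∀ w : ℂ, ‖w‖ = 1 → μ.map (fun z => w * z) = μ) ∧
    -- behaviour of the solution as `t → 0+` inside and outside the disk
    (∀ (z : ℂ) (a a' : ℝ → Fin D → ℂ),
      (∀ t : ℝ, 0 < t → BlockMatrix.IsSolution α g z (t * Complex.I) (a t) (a' t)) →
      (‖z‖ ^ 2 < BlockMatrix.perronEigenvalue α g →
        ∃ C : ℝ, 0 < C ∧ ∀ᶠ t in nhdsWithin (0 : ℝ) (Set.Ioi 0),
          C ≤ ‖∑ c, (α c : ℂ) * a t c‖) ∧
      (BlockMatrix.perronEigenvalue α g < ‖z‖ ^ 2 →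
        Filter.Tendsto a (nhdsWithin 0 (Set.Ioi 0)) (nhds 0) ∧
        Filter.Tendsto a' (nhdsWithin 0 (Set.Ioi 0)) (nhds 0))) := by
  -- For `D = 0` the weights would sum to `0` instead of `1`.
  have hD : Nonempty (Fin D) := by
    by_contra hne
    rw [not_nonempty_iff] at hne
    simp at hsum
  obtain ⟨μ, hμ, huniq, hsupp, hrot⟩ := BlockMatrix.existsUnique_isLimitingMeasure hα hsum hg
  refine ⟨fun z t ht => BlockMatrix.existsUnique_isSolution hα z ht, ⟨μ, hμ, huniq⟩,
    fun ν hν => ?_, fun z a a' h => BlockMatrix.solution_limit hα hg z a a' h⟩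
  rw [huniq ν hν]
  exact ⟨hsupp, hrot⟩
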